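/- Let $0<s<1$ and let $a<b$ be real numbers. For a measurable $u:\mathbb R\to\mathbb R$ set $$[u]_{W^{s,2}(\mathbb R)}=\Big(\iint_{\mathbb R\times\mathbb R}\frac{|u(x)-u(y)|^2}{|x-y|^{1+2s}}\,dx\,dy\Big)^{1/2},\qquad W^{s,2}(\mathbb R)=\{u\in L^2(\mathbb R):[u]_{W^{s,2}(\mathbb R)}<\infty\},$$ and let $\widetilde W^{s,2}_0((a,b))$ be the closure of $C^\infty_0((a,b))$ (functions extended by $0$) in $W^{s,2}(\mathbb R)$ with respect to the norm $\|u\|_{L^2(\mathbb R)}+[u]_{W^{s,2}(\mathbb R)}$. Let $d(t)=\min\{t-a,b-t\}$ be the distance of $t\in(a,b)$ from the boundary of $(a,b)$, and define $$\mathfrak h_{s,2}((a,b))=\inf_{u\in C^\infty_0((a,b))}\Big\{[u]^2_{W^{s,2}(\mathbb R)}:\int_a^b\frac{|u|^2}{d^{2s}}\,dt=1\Big\},\qquad \Lambda_{s,2}=2\int_0^1\frac{\big|1-t^{\frac{2s-1}{2}}\big|^2}{(1-t)^{1+2s}}\,dt+\frac1s .$$ Then $\Lambda_{s,2}$ is finite,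 and $$\Lambda_{s,2}\int_a^b|u|^2\Big[\frac1{t-a}+\frac1{b-t}\Big]^{2s}dt\le[u]^2_{W^{s,2}(\mathbb R)}\qquad\text{for every }u\in\widetilde W^{s,2}_0((a,b)).$$ In particular $\mathfrak h_{s,2}((a,b))=\Lambda_{s,2}$, and this constant is not attained: there is no $u\in\widetilde W^{s,2}_0((a,b))$ with $\int_a^b|u|^2d^{-2s}\,dt=1$ and $[u]^2_{W^{s,2}(\mathbb R)}=\mathfrak h_{s,2}((a,b))$. -/

import Mathlib

open MeasureTheory Set
open scoped ENNReal ContDiff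

namespace FractionalHardy

/-- The Gagliardo-Slobodeckij seminorm of a function on the real line,
`(∬ |u x - u y| ^ p / |x - y| ^ (1 + s p) dx dy) ^ (1 / p)`, as an extended nonnegative number. -/
noncomputable def gagliardoSeminorm (s p : ℝ) (u : ℝ → ℝ) : ℝ≥0∞ :=
  (∫⁻ z : ℝ × ℝ, ENNReal.ofReal (|u z.1 - u z.2| ^ p / |z.1 - z.2| ^ (1 + s * p))) ^ (1 / p)

/-- The fractional Sobolev space `W^{s,p}(ℝ)`, described through representatives. -/
def MemSobolev (s p : ℝ) (u : ℝ → ℝ) : Prop :=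
  MemLp u (ENNReal.ofReal p) volume ∧ gagliardoSeminorm s p u < ⊤

/-- The norm `‖u‖_{L^p(ℝ)} + [u]_{W^{s,p}(ℝ)}` of `W^{s,p}(ℝ)`. -/
noncomputable def sobolevNorm (s p : ℝ) (u : ℝ → ℝ) : ℝ≥0∞ :=
  eLpNorm u (ENNReal.ofReal p) volume + gagliardoSeminorm s p u

/-- Smooth functions with compact support contained in `Ω` (extended by zero outside `Ω`). -/
def IsTestFunction (Ω : Set ℝ) (φ : ℝ → ℝ) : Prop :=
  ContDiff ℝ ∞ φ ∧ HasCompactSupport φ ∧ tsupport φ ⊆ Ω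

/-- The closure of the test functions on `Ω` in `W^{s,p}(ℝ)`. -/
def MemSobolevTildeZero (s p : ℝ) (Ω : Set ℝ) (u : ℝ → ℝ) : Prop :=
  MemSobolev s p u ∧
    ∀ ε : ℝ≥0∞, 0 < ε → ∃ φ : ℝ → ℝ, IsTestFunction Ω φ ∧ sobolevNorm s p (u - φ) < ε

/-- The distance from the boundary of `Ω`. -/
noncomputable def boundaryDist (Ω : Set ℝ) (t : ℝ) : ℝ :=
  Metric.infDist t (frontier Ω)

/-- The weighted integral `∫_Ω |u| ^ p / d_Ω ^ (s p)`. -/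
noncomputable def hardyIntegral (s p : ℝ) (Ω : Set ℝ) (u : ℝ → ℝ) : ℝ≥0∞ :=
  ∫⁻ t in Ω, ENNReal.ofReal (|u t| ^ p / boundaryDist Ω t ^ (s * p))

/-- The sharp fractional `(s,p)`-Hardy constant of `Ω`. -/
noncomputable def hardyConstant (s p : ℝ) (Ω : Set ℝ) : ℝ≥0∞ :=
  ⨅ (u : ℝ → ℝ) (_ : IsTestFunction Ω u) (_ : hardyIntegral s p Ω u = 1),
    gagliardoSeminorm s p u ^ p

/-- The sharp Hardy constant has a minimizer in the closure of the test functions in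
`W^{s,p}(ℝ)`. -/
def HardyConstantAttained (s p : ℝ) (Ω : Set ℝ) : Prop :=
  ∃ u : ℝ → ℝ, MemSobolevTildeZero s p Ω u ∧ hardyIntegral s p Ω u = 1 ∧
    gagliardoSeminorm s p u ^ p = hardyConstant s p Ω

/-- The constant
`2 ∫_0^1 |1 - t ^ ((s p - 1) / p)| ^ p / (1 - t) ^ (1 + s p) dt + 2 / (s p)`. -/
noncomputable def sharpConstant (s p : ℝ) : ℝ≥0∞ :=
  2 * (∫⁻ t in Ioo (0 : ℝ) 1,
      ENNReal.ofReal (|1 - t ^ ((s * p - 1) / p)| ^ p / (1 - t) ^ (1 + s * p))) +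
    ENNReal.ofReal (2 / (s * p))

end FractionalHardy

namespace FractionalHardy

/-! Put u = w h, where w(t) = ((t-a)(b-t))^(s-1/2) is the ground state, and W = 1/(t-a) + 1/(b-t).
Expanding squares gives (u(x)-u(y))^2 + w(x)w(y)(h(x)^2 + h(y)^2) = w(x)w(y)(h(x)-h(y))^2 + u(x)^2 +
u(y)^2. Integrated against |x-y|^(-1-2s), the terms carrying a single value of h turn into multiples
of the weighted mass of u, namely the integral of u^2 W^(2s), but they diverge on the diagonal.

The cure is a conformally natural cutoff: keep only pairs whose cross ratio with a and b is at
distance from 1 measured by a parameter θ < 1. The cross ratio as new variable turns the integral of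
w(y)|x-y|^(-1-2s) into w(x) W(x)^(2s) times a number depending on θ alone (`lintegral_groundState`),
and the integral of the bare kernel is explicit (`lintegral_section`). The two divergences cancel up
to O((1-θ)^(2-2s)) (`truncated_sharpConstant`, `abs_sectionMass_sub_le`), and what remains is the
sharp constant. As θ tends to 1, the seminorm squared is bounded below by the constant times the
weighted mass, and above by that plus the ground energy of h. Fatou's lemma and the triangle
inequality carry the lower bound to the closure.

For optimality, h is a bump of width T in the coordinate log((x-a)/(b-x)). The ground energy is
O(1/T) while the mass grows at least like T. The bump sits so close to a that 1/d and W agree up to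
a factor tending to 1, so the quotients reach the constant. Since 1/d < W everywhere, a minimizer
would have weighted mass above 1 and would violate the Hardy inequality. -/

/-! ### One-dimensional integrals behind the sharp constant. -/

/-- The fundamental theorem of calculus for the lower integral of a nonnegative derivative. -/
theorem lintegral_Ioo_of_hasDerivAt_of_nonneg {g g' : ℝ → ℝ} {a b : ℝ} (hab : a ≤ b)
    (hc : ContinuousOn g (Icc a b)) (hd : ∀ x ∈ Ioo a b, HasDerivAt g (g' x) x)
    (hn : ∀ x ∈ Ioo a b, 0 ≤ g' x) :
    ∫⁻ x in Ioo a b, ENNReal.ofReal (g' x) = ENNReal.ofReal (g b - g a) := by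
  have hi : IntegrableOn g' (Ioc a b) volume :=
    intervalIntegral.integrableOn_deriv_of_nonneg hc hd hn
  have hii : IntervalIntegrable g' volume a b :=
    (intervalIntegrable_iff_integrableOn_Ioc_of_le hab).2 hi
  rw [← intervalIntegral.integral_eq_sub_of_hasDerivAt_of_le hab hc hd hii,
    intervalIntegral.integral_of_le hab, integral_Ioc_eq_integral_Ioo,
    ofReal_integral_eq_lintegral_ofReal (hi.mono_set Ioo_subset_Ioc_self)]
  exact (ae_restrict_iff' measurableSet_Ioo).2 (Filter.Eventually.of_forall hn)

/-- Convergence of the Beta integral. -/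
theorem lintegral_rpow_mul_one_sub_rpow_lt_top {p q : ℝ} (hp : -1 < p) (hq : -1 < q) :
    ∫⁻ t in Ioo (0 : ℝ) 1, ENNReal.ofReal (t ^ p * (1 - t) ^ q) < ⊤ := by
  have hb : 0 < ProbabilityTheory.beta (p + 1) (q + 1) :=
    ProbabilityTheory.beta_pos (by linarith) (by linarith)
  have h1 : ∀ t ∈ Ioo (0 : ℝ) 1, ENNReal.ofReal (t ^ p * (1 - t) ^ q) =
      ENNReal.ofReal (ProbabilityTheory.beta (p + 1) (q + 1)) *
        ProbabilityTheory.betaPDF (p + 1) (q + 1) t := by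
    intro t ht
    rw [ProbabilityTheory.betaPDF_of_pos_lt_one ht.1 ht.2, ← ENNReal.ofReal_mul hb.le]
    congr 1
    simp only [add_sub_cancel_right]
    field_simp
  rw [setLIntegral_congr_fun measurableSet_Ioo h1, lintegral_const_mul' _ _ ENNReal.ofReal_ne_top]
  refine ENNReal.mul_lt_top ENNReal.ofReal_lt_top ?_
  refine lt_of_le_of_lt (setLIntegral_le_lintegral _ _) ?_
  rw [ProbabilityTheory.lintegral_betaPDF_eq_one (by linarith) (by linarith)]
  exact ENNReal.one_lt_top

/-- The kernel of the regional energy in logarithmic coordinates, as a density in the ratio. -/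
noncomputable def radialKernel (s t : ℝ) : ℝ := t ^ (s - 1 / 2) / (1 - t) ^ (1 + s * 2)

theorem radialKernel_nonneg (s : ℝ) {t : ℝ} (ht : t ∈ Ioo (0 : ℝ) 1) : 0 ≤ radialKernel s t :=
  div_nonneg (Real.rpow_nonneg ht.1.le _) (Real.rpow_nonneg (by linarith [ht.2]) _)

/-- The integrand of the sharp constant. -/
noncomputable def sharpIntegrand (s t : ℝ) : ℝ :=
  |1 - t ^ ((s * 2 - 1) / 2)| ^ (2 : ℝ) / (1 - t) ^ (1 + s * 2)

theorem sharpIntegrand_nonneg (s : ℝ) {t : ℝ} (ht : t ∈ Ioo (0 : ℝ) 1) :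
    0 ≤ sharpIntegrand s t :=
  div_nonneg (Real.rpow_nonneg (abs_nonneg _) _) (Real.rpow_nonneg (by linarith [ht.2]) _)

theorem measurable_sharpIntegrand (s : ℝ) : Measurable (sharpIntegrand s) := by
  unfold sharpIntegrand
  fun_prop

theorem sharpConstant_two (s : ℝ) :
    sharpConstant s 2 = 2 * (∫⁻ t in Ioo (0 : ℝ) 1, ENNReal.ofReal (sharpIntegrand s t)) +
      ENNReal.ofReal (1 / s) := by
  unfold sharpConstant sharpIntegrand
  congr 2
  rw [mul_comm s 2, div_mul_eq_div_div]
  norm_num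

/-- With τ = t^(s-1/2) this is 2(1-τ)^2 + 4τ = 2(1+τ^2): the cross term disappears, and the right
side has an elementary antiderivative. -/
theorem sharpIntegrand_add_radialKernel (s : ℝ) {t : ℝ} (ht : t ∈ Ioo (0 : ℝ) 1) :
    2 * sharpIntegrand s t + 4 * radialKernel s t =
      2 * (1 + t ^ (2 * s - 1)) * (1 - t) ^ (-(2 * s) - 1) := by
  have h1 : (0 : ℝ) < 1 - t := by linarith [ht.2]
  have e1 : (1 - t) ^ (-(2 * s) - 1) = ((1 - t) ^ (1 + s * 2))⁻¹ := by
    rw [← Real.rpow_neg h1.le]; congr 1; ring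
  have e2 : t ^ (2 * s - 1) = (t ^ (s - 1 / 2)) ^ 2 := by
    rw [← Real.rpow_natCast, ← Real.rpow_mul ht.1.le]; congr 1; push_cast; ring
  have e3 : (s * 2 - 1) / 2 = s - 1 / 2 := by ring
  unfold sharpIntegrand radialKernel
  rw [e1, e2, e3, Real.rpow_two, sq_abs]
  have : (1 - t) ^ (1 + s * 2) ≠ 0 := (Real.rpow_pos_of_pos h1 _).ne'
  field_simp
  ring

theorem hasDerivAt_rpow_antiderivative {s : ℝ} (hs : 0 < s) {t : ℝ} (ht : t ∈ Ioo (0 : ℝ) 1) :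
    HasDerivAt (fun t : ℝ => (1 / s) * ((1 + t ^ (2 * s)) * (1 - t) ^ (-(2 * s))))
      (2 * (1 + t ^ (2 * s - 1)) * (1 - t) ^ (-(2 * s) - 1)) t := by
  have h1 : (0 : ℝ) < 1 - t := by linarith [ht.2]
  have d1 : HasDerivAt (fun t : ℝ => 1 + t ^ (2 * s)) (2 * s * t ^ (2 * s - 1)) t :=
    (Real.hasDerivAt_rpow_const (Or.inl ht.1.ne')).const_add 1
  have d2 : HasDerivAt (fun t : ℝ => (1 - t) ^ (-(2 * s)))
      (-1 * -(2 * s) * (1 - t) ^ (-(2 * s) - 1)) t := by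
    have := ((hasDerivAt_id t).const_sub 1).rpow_const (p := -(2 * s)) (Or.inl h1.ne')
    simpa using this
  have d3 := (d1.mul d2).const_mul (1 / s)
  refine d3.congr_deriv ?_
  have e1 : (1 - t) ^ (-(2 * s)) = (1 - t) ^ (-(2 * s) - 1) * (1 - t) := by
    rw [← Real.rpow_add_one h1.ne']; congr 1; ring
  have e2 : t ^ (2 * s) = t ^ (2 * s - 1) * t := by
    rw [← Real.rpow_add_one ht.1.ne']; congr 1; ring
  simp only [e1, e2]
  field_simp
  ring

/-- Truncated form of the relation between the sharp constant and the mass of the kernel. -/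
theorem truncated_sharpConstant {s : ℝ} (hs : 0 < s) {θ : ℝ} (hθ : θ ∈ Ioo (0 : ℝ) 1) :
    2 * (∫⁻ t in Ioo 0 θ, ENNReal.ofReal (sharpIntegrand s t)) + ENNReal.ofReal (1 / s) +
        4 * (∫⁻ t in Ioo 0 θ, ENNReal.ofReal (radialKernel s t)) =
      ENNReal.ofReal ((1 / s) * ((1 + θ ^ (2 * s)) * (1 - θ) ^ (-(2 * s)))) := by
  have hsub : ∀ t ∈ Ioo 0 θ, t ∈ Ioo (0 : ℝ) 1 := fun t ht => ⟨ht.1, ht.2.trans hθ.2⟩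
  have h0 : ∫⁻ t in Ioo 0 θ, ENNReal.ofReal (2 * (1 + t ^ (2 * s - 1)) * (1 - t) ^ (-(2 * s) - 1))
      = ENNReal.ofReal ((1 / s) * ((1 + θ ^ (2 * s)) * (1 - θ) ^ (-(2 * s))) - 1 / s) := by
    rw [lintegral_Ioo_of_hasDerivAt_of_nonneg hθ.1.le
      (g := fun t : ℝ => (1 / s) * ((1 + t ^ (2 * s)) * (1 - t) ^ (-(2 * s))))]
    · congr 2
      -- The antiderivative equals 1/s at 0, which is exactly the additive term of the sharp
      -- constant.
      simp [Real.zero_rpow (by linarith : 2 * s ≠ 0)]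
    · refine continuousOn_const.mul (ContinuousOn.mul ?_ ?_)
      · exact continuousOn_const.add (continuousOn_id.rpow_const fun x _ => Or.inr (by linarith))
      · exact (continuousOn_const.sub continuousOn_id).rpow_const fun x hx =>
          Or.inl (by have := hx.2; change (1 : ℝ) - x ≠ 0; linarith [hθ.2])
    · exact fun x hx => hasDerivAt_rpow_antiderivative hs (hsub x hx)
    · intro x hx
      have := hsub x hx
      have h1 : (0 : ℝ) < 1 - x := by linarith [this.2]
      have := this.1
      positivity
  have h1 : 2 * (∫⁻ t in Ioo 0 θ, ENNReal.ofReal (sharpIntegrand s t)) +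
        4 * (∫⁻ t in Ioo 0 θ, ENNReal.ofReal (radialKernel s t)) =
      ∫⁻ t in Ioo 0 θ, ENNReal.ofReal (2 * (1 + t ^ (2 * s - 1)) * (1 - t) ^ (-(2 * s) - 1)) := by
    rw [← lintegral_const_mul' _ _ (by simp), ← lintegral_const_mul' _ _ (by simp),
      ← lintegral_add_left ((measurable_sharpIntegrand s).ennreal_ofReal.const_mul _)]
    refine setLIntegral_congr_fun measurableSet_Ioo fun t ht => ?_
    have ht := hsub t ht
    rw [← sharpIntegrand_add_radialKernel s ht, ENNReal.ofReal_add
      (mul_nonneg (by norm_num) (sharpIntegrand_nonneg s ht))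
      (mul_nonneg (by norm_num) (radialKernel_nonneg s ht)),
      ENNReal.ofReal_mul (by norm_num), ENNReal.ofReal_mul (by norm_num)]
    norm_num
  have hge : 1 / s ≤ (1 / s) * ((1 + θ ^ (2 * s)) * (1 - θ) ^ (-(2 * s))) := by
    have a1 : 1 ≤ 1 + θ ^ (2 * s) := by linarith [Real.rpow_nonneg hθ.1.le (2 * s)]
    have a2 : 1 ≤ (1 - θ) ^ (-(2 * s)) :=
      Real.one_le_rpow_of_pos_of_le_one_of_nonpos (by linarith [hθ.2]) (by linarith [hθ.1])
        (by linarith)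
    have := one_le_mul_of_one_le_of_one_le a1 a2
    exact le_mul_of_one_le_right (by positivity) this
  rw [add_right_comm, h1, h0, ← ENNReal.ofReal_add (by linarith) (by positivity)]
  congr 1
  ring

theorem rpow_neg_sub_one_le {δ t : ℝ} (hδ1 : δ ≤ 1) (ht : t ∈ Ioo (0 : ℝ) 1) :
    t ^ (-δ) - 1 ≤ t ^ (-δ) * (1 - t) := by
  have h1 : t ≤ t ^ δ := by
    simpa using Real.rpow_le_rpow_of_exponent_ge ht.1 ht.2.le hδ1
  have h2 : t ^ (-δ) * t ^ δ = 1 := by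
    rw [← Real.rpow_add ht.1]; simp
  have h3 : 0 ≤ t ^ (-δ) := Real.rpow_nonneg ht.1.le _
  nlinarith

/-- The numerator of the sharp integrand vanishes to second order at t = 1. The sign of s - 1/2
decides whether the power is bounded or blows up at 0; the factor on the right covers both cases. -/
theorem sq_one_sub_rpow_le {s t : ℝ} (hs0 : 0 < s) (hs1 : s < 1) (ht : t ∈ Ioo (0 : ℝ) 1) :
    (1 - t ^ (s - 1 / 2)) ^ 2 ≤ (1 + t ^ (2 * s - 1)) * (1 - t) ^ 2 := by
  have ht0 := ht.1
  rcases le_or_gt (1 / 2) s with h | h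
  · have h1 : t ≤ t ^ (s - 1 / 2) := by
      simpa using Real.rpow_le_rpow_of_exponent_ge ht.1 ht.2.le (by linarith : s - 1 / 2 ≤ 1)
    have h2 : t ^ (s - 1 / 2) ≤ 1 := Real.rpow_le_one ht.1.le ht.2.le (by linarith)
    have h3 : 0 ≤ t ^ (2 * s - 1) := by positivity
    have h4 : (1 - t ^ (s - 1 / 2)) ^ 2 ≤ (1 - t) ^ 2 := by
      apply pow_le_pow_left₀ <;> linarith
    nlinarith [sq_nonneg (1 - t)]
  · have h1 := rpow_neg_sub_one_le (δ := 1 / 2 - s) (by linarith) ht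
    rw [neg_sub] at h1
    have h2 : 1 ≤ t ^ (s - 1 / 2) :=
      Real.one_le_rpow_of_pos_of_le_one_of_nonpos ht.1 ht.2.le (by linarith)
    have e2 : t ^ (2 * s - 1) = (t ^ (s - 1 / 2)) ^ 2 := by
      rw [← Real.rpow_natCast, ← Real.rpow_mul ht.1.le]; congr 1; push_cast; ring
    have h4 : (t ^ (s - 1 / 2) - 1) ^ 2 ≤ (t ^ (s - 1 / 2) * (1 - t)) ^ 2 := by
      apply pow_le_pow_left₀ <;> linarith
    rw [e2]
    nlinarith [sq_nonneg (1 - t)]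

theorem one_sub_sq_div_rpow {s t : ℝ} (ht : t ∈ Ioo (0 : ℝ) 1) :
    (1 - t) ^ 2 / (1 - t) ^ (1 + s * 2) = (1 - t) ^ (1 - 2 * s) := by
  have h1 : (0 : ℝ) < 1 - t := by linarith [ht.2]
  rw [← Real.rpow_two, ← Real.rpow_sub h1]
  congr 1; ring

theorem sharpConstant_lt_top {s : ℝ} (hs0 : 0 < s) (hs1 : s < 1) : sharpConstant s 2 < ⊤ := by
  rw [sharpConstant_two]
  refine ENNReal.add_lt_top.2 ⟨ENNReal.mul_lt_top (by simp) ?_, ENNReal.ofReal_lt_top⟩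
  have h1 := lintegral_rpow_mul_one_sub_rpow_lt_top (p := 0) (q := 1 - 2 * s) (by norm_num)
    (by linarith)
  have h2 := lintegral_rpow_mul_one_sub_rpow_lt_top (p := 2 * s - 1) (q := 1 - 2 * s)
    (by linarith) (by linarith)
  refine lt_of_le_of_lt ?_ (ENNReal.add_lt_top.2 ⟨h1, h2⟩)
  rw [← lintegral_add_left (by fun_prop)]
  refine setLIntegral_mono' measurableSet_Ioo fun t ht => ?_
  have h1 : (0 : ℝ) < 1 - t := by linarith [ht.2]
  have ht0 := ht.1
  rw [← ENNReal.ofReal_add (by positivity) (by positivity)]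
  apply ENNReal.ofReal_le_ofReal
  unfold sharpIntegrand
  rw [Real.rpow_two, sq_abs, ← one_sub_sq_div_rpow ht, show (s * 2 - 1) / 2 = s - 1 / 2 by ring,
    Real.rpow_zero, ← add_mul, ← mul_div_assoc]
  gcongr
  exact sq_one_sub_rpow_le hs0 hs1 ht

/-- The kernel alone is not integrable at t = 1, but the squared logarithm vanishes there to second
order. This is the constant in the energy bound for functions Lipschitz in the logarithmic
coordinate. -/
theorem lintegral_radialKernel_mul_log_sq_lt_top {s : ℝ} (hs0 : 0 < s) (hs1 : s < 1) :
    ∫⁻ t in Ioo (0 : ℝ) 1, ENNReal.ofReal (radialKernel s t) *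
      ENNReal.ofReal (Real.log t ^ 2) < ⊤ := by
  have h2 := lintegral_rpow_mul_one_sub_rpow_lt_top (p := -1 / 2) (q := 1 - 2 * s)
    (by norm_num) (by linarith)
  have h3 := ENNReal.mul_lt_top (a := ENNReal.ofReal (4 / s ^ 2)) ENNReal.ofReal_lt_top h2
  refine lt_of_le_of_lt ?_ h3
  rw [← lintegral_const_mul' _ _ ENNReal.ofReal_ne_top]
  refine setLIntegral_mono' measurableSet_Ioo fun t ht => ?_
  have h1 : (0 : ℝ) < 1 - t := by linarith [ht.2]
  have ht0 := ht.1
  rw [← ENNReal.ofReal_mul (radialKernel_nonneg s ht), ← ENNReal.ofReal_mul (by positivity)]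
  apply ENNReal.ofReal_le_ofReal
  -- The exponent s/2 loses t^(-s) after squaring, and t^(s-1/2) t^(-s) = t^(-1/2) is still
  -- integrable at 0.
  have l1 : -Real.log t * (s / 2) ≤ t ^ (-(s / 2)) * (1 - t) := by
    refine le_trans ?_ (rpow_neg_sub_one_le (by linarith) ht)
    have := Real.log_le_sub_one_of_pos (Real.rpow_pos_of_pos ht0 (-(s / 2)))
    rw [Real.log_rpow ht0] at this
    linarith
  have l2 : Real.log t ≤ 0 := Real.log_nonpos ht0.le ht.2.le
  have l3 : (Real.log t) ^ 2 * (s / 2) ^ 2 ≤ t ^ (-s) * (1 - t) ^ 2 := by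
    have e : t ^ (-s) = (t ^ (-(s / 2))) ^ 2 := by
      rw [← Real.rpow_natCast, ← Real.rpow_mul ht.1.le]; congr 1; push_cast; ring
    rw [e, ← mul_pow, ← mul_pow, ← neg_sq, ← neg_mul]
    exact pow_le_pow_left₀ (mul_nonneg (by linarith) (by linarith)) l1 2
  have l4 : Real.log t ^ 2 ≤ 4 / s ^ 2 * (t ^ (-s) * (1 - t) ^ 2) := by
    have : 4 / s ^ 2 * (Real.log t ^ 2 * (s / 2) ^ 2) = Real.log t ^ 2 := by field_simp; ring
    rw [← this]
    gcongr
  calc radialKernel s t * Real.log t ^ 2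
      ≤ radialKernel s t * (4 / s ^ 2 * (t ^ (-s) * (1 - t) ^ 2)) :=
        mul_le_mul_of_nonneg_left l4 (radialKernel_nonneg s ht)
    _ = 4 / s ^ 2 * (t ^ (-1 / 2 : ℝ) * (1 - t) ^ (1 - 2 * s)) := by
        rw [← one_sub_sq_div_rpow ht, show (-1 / 2 : ℝ) = (s - 1 / 2) + (-s) by ring,
          Real.rpow_add ht0]
        unfold radialKernel
        ring

/-- Bernoulli's inequality at -z gives one side. At y = z/(1-z), where (1+y)(1-z) = 1, it bounds the
reciprocal power and gives the other. Its direction flips at p = 1, hence the two cases. -/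
theorem abs_one_sub_rpow_sub_le {p z : ℝ} (hp0 : 0 < p) (hp2 : p < 2) (hz0 : 0 ≤ z)
    (hz : z ≤ 1 / 2) : |(1 - z) ^ p - (1 - p * z)| ≤ 16 * z ^ 2 := by
  have hz1 : 0 < 1 - z := by linarith
  set y := z / (1 - z) with hy
  have hy0 : 0 ≤ y := by positivity
  have hyz : y * (1 - z) = z := by rw [hy]; field_simp
  have hy1 : z ≤ y := by nlinarith
  have hy2 : y ≤ z + 2 * z ^ 2 := by nlinarith [sq_nonneg z, mul_nonneg hz0 (sq_nonneg z)]
  have hy3 : y ≤ 2 * z := by nlinarith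
  have hpy : 0 < 1 + p * y := by positivity
  have hinv : (1 + y) ^ p * (1 - z) ^ p = 1 := by
    rw [← Real.mul_rpow (by linarith) hz1.le]
    have : (1 + y) * (1 - z) = 1 := by nlinarith
    rw [this, Real.one_rpow]
  have hpos : 0 < (1 - z) ^ p := Real.rpow_pos_of_pos hz1 _
  rw [abs_le]
  rcases le_or_gt 1 p with h | h
  · have h1 := one_add_mul_self_le_rpow_one_add (s := -z) (by linarith) h
    have h2 := one_add_mul_self_le_rpow_one_add (s := y) (by linarith) h
    rw [← sub_eq_add_neg] at h1
    constructor
    · nlinarith [sq_nonneg z]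
    · have h3 : (1 + p * y) * (1 - z) ^ p ≤ 1 :=
        (mul_le_mul_of_nonneg_right h2 hpos.le).trans hinv.le
      have h4 : 1 ≤ (1 + p * y) * (1 - p * y + p ^ 2 * y ^ 2) := by
        have : 0 ≤ (p * y) ^ 3 := by positivity
        nlinarith
      have h5 : (1 - z) ^ p ≤ 1 - p * y + p ^ 2 * y ^ 2 :=
        le_of_mul_le_mul_left (h3.trans h4) hpy
      have h6 : p ^ 2 * y ^ 2 ≤ 2 ^ 2 * (2 * z) ^ 2 := by gcongr
      have h7 : p * z ≤ p * y := by gcongr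
      nlinarith
  · have h1 := rpow_one_add_le_one_add_mul_self (s := -z) (by linarith) hp0.le h.le
    have h2 := rpow_one_add_le_one_add_mul_self (s := y) (by linarith) hp0.le h.le
    rw [← sub_eq_add_neg] at h1
    constructor
    · have h3 : 1 ≤ (1 + p * y) * (1 - z) ^ p :=
        hinv.ge.trans (mul_le_mul_of_nonneg_right h2 hpos.le)
      have h4 : (1 + p * y) * (1 - p * y) ≤ 1 := by nlinarith [sq_nonneg (p * y)]
      have h5 : 1 - p * y ≤ (1 - z) ^ p := le_of_mul_le_mul_left (h4.trans h3) hpy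
      have h6 : p * y ≤ p * (z + 2 * z ^ 2) := by gcongr
      nlinarith [sq_nonneg z]
    · nlinarith [sq_nonneg z]

/-! ### Ground state, kernel, weight and cross ratio. -/

/-- The ground state `((t - a) (b - t)) ^ (s - 1 / 2)` of the interval, extended by zero. -/
noncomputable def groundState (s a b : ℝ) : ℝ → ℝ :=
  (Ioo a b).indicator fun t => ((t - a) * (b - t)) ^ (s - 1 / 2)

/-- The kernel of the Gagliardo seminorm. -/
noncomputable def gagliardoKernel (s x y : ℝ) : ℝ := (|x - y| ^ (1 + s * 2))⁻¹

/-- The weight `1 / (t - a) + 1 / (b - t)`. -/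
noncomputable def intervalWeight (a b t : ℝ) : ℝ := 1 / (t - a) + 1 / (b - t)

/-- The cross ratio of `a`, `b`, `x` and `y`. -/
noncomputable def crossRatio (a b x y : ℝ) : ℝ := ((y - a) * (b - x)) / ((x - a) * (b - y))

section Basic

variable {s a b : ℝ}

theorem groundState_of_mem {t : ℝ} (ht : t ∈ Ioo a b) :
    groundState s a b t = ((t - a) * (b - t)) ^ (s - 1 / 2) := indicator_of_mem ht _

theorem groundState_of_notMem {t : ℝ} (ht : t ∉ Ioo a b) : groundState s a b t = 0 :=
  indicator_of_notMem ht _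

theorem groundState_pos {t : ℝ} (ht : t ∈ Ioo a b) : 0 < groundState s a b t := by
  rw [groundState_of_mem ht]
  exact Real.rpow_pos_of_pos (mul_pos (sub_pos.2 ht.1) (sub_pos.2 ht.2)) _

theorem groundState_nonneg (s a b t : ℝ) : 0 ≤ groundState s a b t := by
  by_cases ht : t ∈ Ioo a b
  · exact (groundState_pos ht).le
  · exact (groundState_of_notMem ht).ge

theorem measurable_groundState (s a b : ℝ) : Measurable (groundState s a b) := by
  unfold groundState
  exact Measurable.indicator (by fun_prop) measurableSet_Ioo

theorem gagliardoKernel_nonneg (s x y : ℝ) : 0 ≤ gagliardoKernel s x y :=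
  inv_nonneg.2 (Real.rpow_nonneg (abs_nonneg _) _)

theorem gagliardoKernel_comm (s x y : ℝ) : gagliardoKernel s x y = gagliardoKernel s y x := by
  unfold gagliardoKernel
  rw [abs_sub_comm]

theorem measurable_gagliardoKernel (s : ℝ) :
    Measurable fun z : ℝ × ℝ => gagliardoKernel s z.1 z.2 := by
  unfold gagliardoKernel
  fun_prop

theorem gagliardoKernel_self (hs : 0 < s) (x : ℝ) : gagliardoKernel s x x = 0 := by
  unfold gagliardoKernel
  rw [sub_self, abs_zero, Real.zero_rpow (by linarith), inv_zero]

theorem intervalWeight_eq {t : ℝ} (ht : t ∈ Ioo a b) :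
    intervalWeight a b t = (b - a) / ((t - a) * (b - t)) := by
  have h1 : t - a ≠ 0 := (sub_pos.2 ht.1).ne'
  have h2 : b - t ≠ 0 := (sub_pos.2 ht.2).ne'
  unfold intervalWeight
  field_simp
  ring

theorem intervalWeight_pos {t : ℝ} (ht : t ∈ Ioo a b) : 0 < intervalWeight a b t := by
  have h1 : 0 < t - a := sub_pos.2 ht.1
  have h2 : 0 < b - t := sub_pos.2 ht.2
  unfold intervalWeight
  positivity

theorem measurable_intervalWeight (a b : ℝ) : Measurable (intervalWeight a b) := by
  unfold intervalWeight
  fun_prop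

end Basic

/-! ### The cross ratio as integration variable. -/

section ChangeOfVariables

variable {s a b x : ℝ}

theorem crossRatio_image (hx : x ∈ Ioo a b) :
    (fun y => crossRatio a b x y) '' Ioo a x = Ioo 0 1 := by
  have hp : 0 < x - a := sub_pos.2 hx.1
  have hq : 0 < b - x := sub_pos.2 hx.2
  ext t
  constructor
  · rintro ⟨y, hy, rfl⟩
    have hr : 0 < y - a := sub_pos.2 hy.1
    have hv : 0 < b - y := by linarith [hy.2]
    simp only [crossRatio]
    refine ⟨by positivity, ?_⟩
    rw [div_lt_one (by positivity)]
    nlinarith [mul_pos (sub_pos.2 hy.2) (sub_pos.2 (hx.1.trans hx.2))]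
  · rintro ⟨h0, h1⟩
    have hD : 0 < (b - x) + t * (x - a) := by positivity
    -- The witness solves (y-a)(b-x) = t(x-a)(b-y), which is linear in y.
    refine ⟨a + t * (x - a) * (b - a) / ((b - x) + t * (x - a)), ⟨?_, ?_⟩, ?_⟩
    · have : 0 < b - a := by linarith
      have : 0 < t * (x - a) * (b - a) / ((b - x) + t * (x - a)) := by positivity
      linarith
    · rw [← lt_sub_iff_add_lt', div_lt_iff₀ hD]
      nlinarith [mul_pos hp hq, mul_pos (mul_pos hp hq) (sub_pos.2 h1)]
    · have e1 : a + t * (x - a) * (b - a) / ((b - x) + t * (x - a)) - a =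
          t * (x - a) * (b - a) / ((b - x) + t * (x - a)) := by ring
      have e2 : b - (a + t * (x - a) * (b - a) / ((b - x) + t * (x - a))) =
          (b - x) * (b - a) / ((b - x) + t * (x - a)) := by
        field_simp
        ring
      have : b - a ≠ 0 := by linarith
      simp only [crossRatio]
      rw [e1, e2]
      field_simp

theorem crossRatio_injOn (hx : x ∈ Ioo a b) : InjOn (fun y => crossRatio a b x y) (Ioo a x) := by
  have hp : 0 < x - a := sub_pos.2 hx.1
  have hq : 0 < b - x := sub_pos.2 hx.2
  intro y hy z hz h
  have hv : 0 < b - y := by linarith [hy.2]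
  have hv' : 0 < b - z := by linarith [hz.2]
  simp only [crossRatio] at h
  rw [div_eq_div_iff (by positivity) (by positivity)] at h
  have h2 : ((x - a) * (b - x)) * ((b - a) * (y - z)) = 0 := by linarith
  have h3 : b - a ≠ 0 := by linarith
  have h4 : y - z = 0 := by
    have := mul_pos hp hq
    simpa [this.ne', hp.ne', hq.ne', h3] using h2
  linarith

theorem crossRatio_hasDerivAt (hx : x ∈ Ioo a b) {y : ℝ} (hy : y ∈ Ioo a x) :
    HasDerivAt (fun y => crossRatio a b x y)
      ((b - x) * (b - a) / ((x - a) * (b - y) ^ 2)) y := by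
  have hp : 0 < x - a := sub_pos.2 hx.1
  have hv : 0 < b - y := by linarith [hy.2, hx.2]
  have d1 : HasDerivAt (fun y => (y - a) * (b - x)) (1 * (b - x)) y :=
    ((hasDerivAt_id y).sub_const a).mul_const _
  have d2 : HasDerivAt (fun y => (x - a) * (b - y)) ((x - a) * (-1)) y :=
    ((hasDerivAt_id y).const_sub b).const_mul _
  refine (d1.div d2 (by positivity)).congr_deriv ?_
  field_simp
  ring

/-- The reason for the exponent s - 1/2: since 1 minus the cross ratio is (b-a)(x-y)/((x-a)(b-y)),
every remaining power of b - y is absorbed by the Jacobian, leaving a function of the ratio times a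
function of x. -/
theorem radialKernel_crossRatio (hx : x ∈ Ioo a b) {y : ℝ} (hy : y ∈ Ioo a x) :
    groundState s a b y * gagliardoKernel s x y =
      groundState s a b x * intervalWeight a b x ^ (2 * s) *
        ((b - x) * (b - a) / ((x - a) * (b - y) ^ 2) *
          radialKernel s (crossRatio a b x y)) := by
  have hy' : y ∈ Ioo a b := ⟨hy.1, hy.2.trans hx.2⟩
  have hd : 0 < x - y := sub_pos.2 hy.2
  have hone : 1 - crossRatio a b x y = ((b - a) * (x - y)) / ((x - a) * (b - y)) := by
    have hp : x - a ≠ 0 := (sub_pos.2 hx.1).ne'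
    have hv : b - y ≠ 0 := (sub_pos.2 hy'.2).ne'
    unfold crossRatio
    field_simp
    ring
  rw [groundState_of_mem hx, groundState_of_mem hy', intervalWeight_eq hx]
  unfold radialKernel gagliardoKernel
  rw [hone, abs_of_pos hd]
  unfold crossRatio
  have hp : 0 < x - a := sub_pos.2 hx.1
  have hq : 0 < b - x := sub_pos.2 hx.2
  have hr : 0 < y - a := sub_pos.2 hy.1
  have hv : 0 < b - y := sub_pos.2 hy'.2
  have hl : 0 < b - a := by linarith
  -- The identity is now purely multiplicative, so the six lengths may be treated as independent;
  -- all powers reduce to z^(s-1/2) and integer powers.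
  generalize x - a = p at *
  generalize b - x = q at *
  generalize y - a = r at *
  generalize b - y = v at *
  generalize b - a = l at *
  generalize x - y = d at *
  have key : ∀ z : ℝ, 0 < z → z ^ (1 + s * 2) = (z ^ (s - 1 / 2)) ^ 2 * z ^ 2 := by
    intro z hz
    rw [← Real.rpow_natCast, ← Real.rpow_mul hz.le, ← Real.rpow_natCast, ← Real.rpow_add hz]
    congr 1; push_cast; ring
  have key2 : ∀ z : ℝ, 0 < z → z ^ (2 * s) = (z ^ (s - 1 / 2)) ^ 2 * z := by
    intro z hz
    rw [← Real.rpow_natCast, ← Real.rpow_mul hz.le, ← Real.rpow_add_one hz.ne']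
    congr 1; push_cast; ring
  have pos : ∀ z : ℝ, 0 < z → z ^ (s - 1 / 2) ≠ 0 := fun z hz => (Real.rpow_pos_of_pos hz _).ne'
  rw [Real.mul_rpow hr.le hv.le, Real.mul_rpow hp.le hq.le,
    Real.div_rpow hl.le (by positivity) (2 * s), Real.mul_rpow hp.le hq.le,
    Real.div_rpow (by positivity) (by positivity) (s - 1 / 2), Real.mul_rpow hr.le hq.le,
    Real.mul_rpow hp.le hv.le, Real.div_rpow (by positivity) (by positivity) (1 + s * 2),
    Real.mul_rpow hl.le hd.le, Real.mul_rpow hp.le hv.le, key p hp, key v hv, key l hl,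
    key d hd, key2 l hl, key2 p hp, key2 q hq]
  have h1 := pos p hp
  have h2 := pos q hq
  have h4 := pos v hv
  have h5 := pos l hl
  have h6 := pos d hd
  field_simp

theorem lintegral_groundState_left (hx : x ∈ Ioo a b) (F : ℝ → ℝ≥0∞) :
    ∫⁻ y in Ioo a x, ENNReal.ofReal (groundState s a b y * gagliardoKernel s x y) *
        F (crossRatio a b x y) =
      ENNReal.ofReal (groundState s a b x * intervalWeight a b x ^ (2 * s)) *
        ∫⁻ t in Ioo (0 : ℝ) 1, ENNReal.ofReal (radialKernel s t) * F t := by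
  rw [← crossRatio_image hx, lintegral_image_eq_lintegral_abs_deriv_mul measurableSet_Ioo
    (fun y hy => (crossRatio_hasDerivAt hx hy).hasDerivWithinAt) (crossRatio_injOn hx),
    ← lintegral_const_mul' _ _ ENNReal.ofReal_ne_top]
  refine setLIntegral_congr_fun measurableSet_Ioo fun y hy => ?_
  have hp : 0 < x - a := sub_pos.2 hx.1
  have hq : 0 < b - x := sub_pos.2 hx.2
  have hl : 0 < b - a := by linarith
  have hv : 0 < b - y := by linarith [hy.2]
  rw [radialKernel_crossRatio hx hy, ENNReal.ofReal_mul
    (mul_nonneg (groundState_nonneg _ _ _ _) (Real.rpow_nonneg (intervalWeight_pos hx).le _)),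
    ENNReal.ofReal_mul (p := (b - x) * (b - a) / ((x - a) * (b - y) ^ 2)) (by positivity),
    abs_of_nonneg (by positivity)]
  ring

/-- The reflection y to -y exchanges the endpoints and reduces this to the left half. -/
theorem lintegral_groundState_right (hx : x ∈ Ioo a b) (F : ℝ → ℝ≥0∞) :
    ∫⁻ y in Ioo x b, ENNReal.ofReal (groundState s a b y * gagliardoKernel s x y) *
        F (crossRatio a b y x) =
      ENNReal.ofReal (groundState s a b x * intervalWeight a b x ^ (2 * s)) *
        ∫⁻ t in Ioo (0 : ℝ) 1, ENNReal.ofReal (radialKernel s t) * F t := by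
  have h := lintegral_groundState_left (s := s) (a := -b) (b := -a) (x := -x)
    ⟨neg_lt_neg hx.2, neg_lt_neg hx.1⟩ F
  have hg : ∀ y, groundState s (-b) (-a) (-y) = groundState s a b y := by
    intro y
    by_cases hy : y ∈ Ioo a b
    · rw [groundState_of_mem hy, groundState_of_mem ⟨neg_lt_neg hy.2, neg_lt_neg hy.1⟩]
      congr 1; ring
    · rw [groundState_of_notMem hy, groundState_of_notMem]
      exact fun h => hy ⟨neg_lt_neg_iff.1 h.2, neg_lt_neg_iff.1 h.1⟩
  have hw : intervalWeight (-b) (-a) (-x) = intervalWeight a b x := by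
    unfold intervalWeight
    rw [add_comm]; congr 2 <;> ring
  rw [hg, hw] at h
  rw [← h, ← lintegral_indicator measurableSet_Ioo, ← lintegral_indicator measurableSet_Ioo,
    ← lintegral_neg_eq_self]
  refine lintegral_congr fun y => ?_
  by_cases hy : y ∈ Ioo (-b) (-x)
  · have hy' : -y ∈ Ioo x b := ⟨lt_neg.2 hy.2, neg_lt.2 hy.1⟩
    rw [indicator_of_mem hy, indicator_of_mem hy']
    have e1 := hg (-y)
    rw [neg_neg] at e1
    rw [e1]
    have e2 : gagliardoKernel s x (-y) = gagliardoKernel s (-x) y := by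
      unfold gagliardoKernel
      rw [← abs_neg]; congr 3; ring
    have e3 : crossRatio a b (-y) x = crossRatio (-b) (-a) (-x) y := by
      unfold crossRatio
      congr 1 <;> ring
    rw [e2, e3]
  · rw [indicator_of_notMem hy, indicator_of_notMem]
    exact fun h => hy ⟨neg_lt.1 h.2, lt_neg.1 h.1⟩

theorem lintegral_groundState (hs : 0 < s) (hx : x ∈ Ioo a b) {F G : ℝ → ℝ≥0∞}
    (hl : ∀ y ∈ Ioo a x, G y = F (crossRatio a b x y))
    (hr : ∀ y ∈ Ioo x b, G y = F (crossRatio a b y x)) :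
    ∫⁻ y, ENNReal.ofReal (groundState s a b y * gagliardoKernel s x y) * G y =
      ENNReal.ofReal (groundState s a b x * intervalWeight a b x ^ (2 * s)) *
        (2 * ∫⁻ t in Ioo (0 : ℝ) 1, ENNReal.ofReal (radialKernel s t) * F t) := by
  have hsup : Function.support (fun y =>
      ENNReal.ofReal (groundState s a b y * gagliardoKernel s x y) * G y) ⊆
      Ioo a x ∪ Ioo x b := by
    intro y hy
    rw [Function.mem_support] at hy
    by_contra hn
    apply hy
    by_cases hxy : y = x
    -- On the diagonal the kernel takes the value 0 by the conventions for zero powers and inverses.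
    · rw [hxy, gagliardoKernel_self hs, mul_zero, ENNReal.ofReal_zero, zero_mul]
    · rw [groundState_of_notMem, zero_mul, ENNReal.ofReal_zero, zero_mul]
      rintro ⟨h1, h2⟩
      rcases lt_or_gt_of_ne hxy with h | h
      · exact hn (Or.inl ⟨h1, h⟩)
      · exact hn (Or.inr ⟨h, h2⟩)
  rw [← setLIntegral_eq_of_support_subset hsup, lintegral_union measurableSet_Ioo,
    setLIntegral_congr_fun measurableSet_Ioo (fun y hy => by rw [hl y hy]),
    setLIntegral_congr_fun (s := Ioo x b) measurableSet_Ioo (fun y hy => by rw [hr y hy]),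
    lintegral_groundState_left hx F, lintegral_groundState_right hx F]
  · ring
  · exact disjoint_left.2 fun y h1 h2 => absurd h1.2 (not_lt.2 h2.1.le)

end ChangeOfVariables

/-! ### Kernel mass away from the diagonal. -/

section Sections

variable {s a b x θ : ℝ}

theorem lintegral_Ioi_rpow_inv (hs : 0 < s) {h : ℝ} (hh : 0 < h) :
    ∫⁻ r in Ioi h, ENNReal.ofReal ((|r| ^ (1 + s * 2))⁻¹) =
      ENNReal.ofReal (1 / (2 * s) * h ^ (-(2 * s))) := by
  have e : 1 / (2 * s) * h ^ (-(2 * s)) = ∫ r in Ioi h, r ^ (-(1 + s * 2)) := by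
    rw [integral_Ioi_rpow_of_lt (by linarith) hh,
      show -(1 + s * 2) + 1 = -(2 * s) by ring]
    field_simp
  rw [e, ofReal_integral_eq_lintegral_ofReal (integrableOn_Ioi_rpow_of_lt (by linarith) hh)]
  · refine setLIntegral_congr_fun measurableSet_Ioi fun r hr => ?_
    have : 0 < r := hh.trans hr
    rw [abs_of_pos this, Real.rpow_neg this.le]
  · exact (ae_restrict_iff' measurableSet_Ioi).2 (Filter.Eventually.of_forall fun r hr =>
      Real.rpow_nonneg (hh.trans hr).le _)

theorem lintegral_Ioi_gagliardoKernel (hs : 0 < s) {h : ℝ} (hh : 0 < h) :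
    ∫⁻ y in Ioi (x + h), ENNReal.ofReal (gagliardoKernel s x y) =
      ENNReal.ofReal (1 / (2 * s) * h ^ (-(2 * s))) := by
  rw [← lintegral_Ioi_rpow_inv hs hh, ← lintegral_indicator measurableSet_Ioi,
    ← lintegral_indicator measurableSet_Ioi, ← lintegral_add_left_eq_self _ x]
  refine lintegral_congr fun r => ?_
  have e : |x - (x + r)| = |r| := by rw [← abs_neg]; congr 1; ring
  simp only [indicator, mem_Ioi, add_lt_add_iff_left, gagliardoKernel, e]

theorem lintegral_Iio_gagliardoKernel (hs : 0 < s) {h : ℝ} (hh : 0 < h) :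
    ∫⁻ y in Iio (x - h), ENNReal.ofReal (gagliardoKernel s x y) =
      ENNReal.ofReal (1 / (2 * s) * h ^ (-(2 * s))) := by
  rw [← lintegral_Ioi_rpow_inv hs hh, ← lintegral_indicator measurableSet_Iio,
    ← lintegral_indicator measurableSet_Ioi, ← lintegral_sub_left_eq_self _ x]
  refine lintegral_congr fun r => ?_
  simp only [indicator, mem_Ioi, mem_Iio, gagliardoKernel, sub_sub_cancel, sub_lt_sub_iff_left]

/-- Pairs of points whose cross ratio stays away from one. -/
def offDiagonal (a b θ : ℝ) : Set (ℝ × ℝ) :=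
  {z | (z.2 - a) * (b - z.1) < θ * ((z.1 - a) * (b - z.2)) ∨
    (z.1 - a) * (b - z.2) < θ * ((z.2 - a) * (b - z.1))}

theorem measurableSet_offDiagonal (a b θ : ℝ) : MeasurableSet (offDiagonal a b θ) :=
  MeasurableSet.union
    (measurableSet_lt (f := fun z : ℝ × ℝ => (z.2 - a) * (b - z.1))
      (g := fun z => θ * ((z.1 - a) * (b - z.2))) (by fun_prop) (by fun_prop))
    (measurableSet_lt (f := fun z : ℝ × ℝ => (z.1 - a) * (b - z.2))
      (g := fun z => θ * ((z.2 - a) * (b - z.1))) (by fun_prop) (by fun_prop))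

theorem swap_mem_offDiagonal {z : ℝ × ℝ} : z.swap ∈ offDiagonal a b θ ↔ z ∈ offDiagonal a b θ :=
  or_comm

/-- The mass of the kernel over a section of the off-diagonal region. -/
noncomputable def sectionMass (s a b θ x : ℝ) : ℝ :=
  1 / (2 * s) * (intervalWeight a b x ^ (2 * s) * (1 - θ) ^ (-(2 * s)) *
    ((1 - (x - a) / (b - a) * (1 - θ)) ^ (2 * s) +
      (1 - (1 - (x - a) / (b - a)) * (1 - θ)) ^ (2 * s)))

/-- Both defining inequalities are linear in y, so the section is the complement of an interval
around x. It also contains the points outside (a, b), which contribute to the seminorm. -/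
theorem section_offDiagonal (hx : x ∈ Ioo a b) (hθ : θ ∈ Ioo (0 : ℝ) 1) :
    {y | (x, y) ∈ offDiagonal a b θ} =
      Iio (x - (x - a) * (b - x) * (1 - θ) / ((b - x) + θ * (x - a))) ∪
        Ioi (x + (x - a) * (b - x) * (1 - θ) / ((x - a) + θ * (b - x))) := by
  have hp : 0 < x - a := sub_pos.2 hx.1
  have hq : 0 < b - x := sub_pos.2 hx.2
  have h0 := hθ.1
  ext y
  simp only [offDiagonal, mem_ofPred_eq, mem_union, mem_Iio, mem_Ioi]
  refine or_congr ?_ ?_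
  · rw [lt_sub_comm, div_lt_iff₀ (by positivity)]
    constructor <;> intro h <;> nlinarith
  · rw [← lt_sub_iff_add_lt', div_lt_iff₀ (by positivity)]
    constructor <;> intro h <;> nlinarith

theorem lintegral_section (hs : 0 < s) (hx : x ∈ Ioo a b) (hθ : θ ∈ Ioo (0 : ℝ) 1) :
    ∫⁻ y in {y | (x, y) ∈ offDiagonal a b θ}, ENNReal.ofReal (gagliardoKernel s x y) =
      ENNReal.ofReal (sectionMass s a b θ x) := by
  have hp : 0 < x - a := sub_pos.2 hx.1
  have hq : 0 < b - x := sub_pos.2 hx.2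
  have hl : 0 < b - a := by linarith
  have h0 := hθ.1
  have h1 : 0 < 1 - θ := sub_pos.2 hθ.2
  -- Each cutoff distance is (1-θ)/W times the inverse of a factor depending only on θ and the
  -- relative position of x; this isolates the power of the weight.
  have e1 : (x - a) * (b - x) * (1 - θ) / ((b - x) + θ * (x - a)) =
      (intervalWeight a b x * (1 - θ)⁻¹ * (1 - (x - a) / (b - a) * (1 - θ)))⁻¹ := by
    have : 1 - (x - a) / (b - a) * (1 - θ) = ((b - x) + θ * (x - a)) / (b - a) := by
      field_simp; ring
    rw [this, intervalWeight_eq hx]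
    field_simp
  have e2 : (x - a) * (b - x) * (1 - θ) / ((x - a) + θ * (b - x)) =
      (intervalWeight a b x * (1 - θ)⁻¹ * (1 - (1 - (x - a) / (b - a)) * (1 - θ)))⁻¹ := by
    have : 1 - (1 - (x - a) / (b - a)) * (1 - θ) = ((x - a) + θ * (b - x)) / (b - a) := by
      field_simp; ring
    rw [this, intervalWeight_eq hx]
    field_simp
  have p1 : 0 < (x - a) * (b - x) * (1 - θ) / ((b - x) + θ * (x - a)) := by positivity
  have p2 : 0 < (x - a) * (b - x) * (1 - θ) / ((x - a) + θ * (b - x)) := by positivity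
  have hw := intervalWeight_pos hx
  have q1 : 0 < 1 - (x - a) / (b - a) * (1 - θ) := by
    have := e1 ▸ p1
    exact pos_of_mul_pos_right (inv_pos.1 this) (by positivity)
  have q2 : 0 < 1 - (1 - (x - a) / (b - a)) * (1 - θ) := by
    have := e2 ▸ p2
    exact pos_of_mul_pos_right (inv_pos.1 this) (by positivity)
  rw [section_offDiagonal hx hθ, lintegral_union measurableSet_Ioi,
    lintegral_Iio_gagliardoKernel hs p1, lintegral_Ioi_gagliardoKernel hs p2,
    ← ENNReal.ofReal_add (by positivity) (by positivity)]
  · congr 1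
    rw [e1, e2, Real.rpow_neg (by positivity), Real.rpow_neg (by positivity),
      Real.inv_rpow (by positivity), Real.inv_rpow (by positivity), inv_inv, inv_inv,
      Real.mul_rpow (by positivity) q1.le, Real.mul_rpow (by positivity) q2.le,
      Real.mul_rpow hw.le (by positivity), Real.inv_rpow h1.le, ← Real.rpow_neg h1.le]
    unfold sectionMass
    ring
  · refine disjoint_left.2 fun y hy1 hy2 => ?_
    rw [mem_Iio] at hy1
    rw [mem_Ioi] at hy2
    linarith

/-- With ε = 1-θ and l the relative position of x, the bracket is (1-lε)^(2s) + (1-(1-l)ε)^(2s) - 1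
- (1-ε)^(2s). Its first-order terms cancel because l + (1-l) = 1. Three remainders of at most 16ε^2
give 48, and ε^(-2s)ε^2 tends to 0 since s < 1. -/
theorem abs_sectionMass_sub_le (hs0 : 0 < s) (hs1 : s < 1) (hx : x ∈ Ioo a b)
    (hθ : θ ∈ Ico (1 / 2 : ℝ) 1) :
    |2 * sectionMass s a b θ x -
        intervalWeight a b x ^ (2 * s) * ((1 / s) * ((1 + θ ^ (2 * s)) * (1 - θ) ^ (-(2 * s))))| ≤
      intervalWeight a b x ^ (2 * s) * (48 / s * (1 - θ) ^ (2 - 2 * s)) := by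
  have hp : 0 < x - a := sub_pos.2 hx.1
  have hq : 0 < b - x := sub_pos.2 hx.2
  have hl : 0 < b - a := by linarith
  have h1 : 0 < 1 - θ := sub_pos.2 hθ.2
  have hε : 1 - θ ≤ 1 / 2 := by linarith [hθ.1]
  have l0 : 0 < (x - a) / (b - a) := by positivity
  have l1 : (x - a) / (b - a) < 1 := by rw [div_lt_one hl]; linarith
  have hw := intervalWeight_pos hx
  have eθ : θ ^ (2 * s) = (1 - (1 - θ)) ^ (2 * s) := by congr 1; ring
  unfold sectionMass
  rw [eθ]
  generalize (x - a) / (b - a) = l at *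
  generalize 1 - θ = ε at *
  have k1 := abs_one_sub_rpow_sub_le (p := 2 * s) (z := l * ε) (by linarith) (by linarith)
    (by positivity) (by nlinarith)
  have k2 := abs_one_sub_rpow_sub_le (p := 2 * s) (z := (1 - l) * ε) (by linarith) (by linarith)
    (mul_nonneg (by linarith) h1.le) (by nlinarith)
  have k3 := abs_one_sub_rpow_sub_le (p := 2 * s) (z := ε) (by linarith) (by linarith) h1.le hε
  have m1 : (l * ε) ^ 2 ≤ ε ^ 2 := pow_le_pow_left₀ (by positivity) (by nlinarith) 2
  have m2 : ((1 - l) * ε) ^ 2 ≤ ε ^ 2 :=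
    pow_le_pow_left₀ (mul_nonneg (by linarith) h1.le) (by nlinarith) 2
  have k : |(1 - l * ε) ^ (2 * s) + (1 - (1 - l) * ε) ^ (2 * s) - (1 + (1 - ε) ^ (2 * s))| ≤
      48 * ε ^ 2 := by
    rw [abs_le] at k1 k2 k3 ⊢
    constructor <;> nlinarith
  have e1 : ε ^ (2 - 2 * s) = ε ^ (-(2 * s)) * ε ^ 2 := by
    rw [← Real.rpow_two, ← Real.rpow_add h1]; congr 1; ring
  have hε0 : 0 < ε ^ (-(2 * s)) := Real.rpow_pos_of_pos h1 _
  have hw0 : 0 < intervalWeight a b x ^ (2 * s) := Real.rpow_pos_of_pos hw _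
  have e2 : 2 * (1 / (2 * s) * (intervalWeight a b x ^ (2 * s) * ε ^ (-(2 * s)) *
      ((1 - l * ε) ^ (2 * s) + (1 - (1 - l) * ε) ^ (2 * s)))) -
      intervalWeight a b x ^ (2 * s) * ((1 / s) * ((1 + (1 - ε) ^ (2 * s)) * ε ^ (-(2 * s)))) =
      intervalWeight a b x ^ (2 * s) * (ε ^ (-(2 * s)) / s) *
      ((1 - l * ε) ^ (2 * s) + (1 - (1 - l) * ε) ^ (2 * s) - (1 + (1 - ε) ^ (2 * s))) := by
    field_simp
  rw [e2, abs_mul, abs_of_pos (by positivity), e1]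
  calc _ ≤ intervalWeight a b x ^ (2 * s) * (ε ^ (-(2 * s)) / s) * (48 * ε ^ 2) := by gcongr
    _ = _ := by ring

end Sections

/-! ### The truncated ground state representation. -/

/-- The part over `R` of the square of the Gagliardo seminorm. -/
noncomputable def gagliardoEnergy (s : ℝ) (R : Set (ℝ × ℝ)) (u : ℝ → ℝ) : ℝ≥0∞ :=
  ∫⁻ z in R, ENNReal.ofReal ((u z.1 - u z.2) ^ 2 * gagliardoKernel s z.1 z.2)

/-- The part over `R` of the energy of `h` in the ground state representation. -/
noncomputable def groundEnergy (s a b : ℝ) (R : Set (ℝ × ℝ)) (h : ℝ → ℝ) : ℝ≥0∞ :=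
  ∫⁻ z in R, ENNReal.ofReal (groundState s a b z.1 * groundState s a b z.2 *
    (h z.1 - h z.2) ^ 2 * gagliardoKernel s z.1 z.2)

/-- The weighted integral on the left hand side of the Hardy inequality. -/
noncomputable def weightedMass (s a b : ℝ) (u : ℝ → ℝ) : ℝ≥0∞ :=
  ∫⁻ t in Ioo a b, ENNReal.ofReal (|u t| ^ 2 * intervalWeight a b t ^ (2 * s))

theorem gagliardoSeminorm_sq (s : ℝ) (u : ℝ → ℝ) :
    gagliardoSeminorm s 2 u ^ 2 = gagliardoEnergy s univ u := by
  unfold gagliardoSeminorm gagliardoEnergy gagliardoKernel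
  rw [← ENNReal.rpow_natCast, ← ENNReal.rpow_mul, Measure.restrict_univ]
  norm_num
  simp only [div_eq_mul_inv]

section Identity

variable {s a b θ : ℝ}

theorem setLIntegral_offDiagonal_swap (f : ℝ × ℝ → ℝ≥0∞) :
    ∫⁻ z in offDiagonal a b θ, f z.swap = ∫⁻ z in offDiagonal a b θ, f z := by
  rw [← lintegral_indicator (measurableSet_offDiagonal a b θ),
    ← lintegral_indicator (measurableSet_offDiagonal a b θ), Measure.volume_eq_prod,
    ← lintegral_prod_swap]
  refine lintegral_congr fun z => ?_
  by_cases hz : z ∈ offDiagonal a b θ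
  · rw [indicator_of_mem hz, indicator_of_mem (swap_mem_offDiagonal.2 hz), Prod.swap_swap]
  · rw [indicator_of_notMem hz, indicator_of_notMem (fun h => hz (swap_mem_offDiagonal.1 h))]

theorem setLIntegral_offDiagonal_prod {f : ℝ × ℝ → ℝ≥0∞} (hf : Measurable f) :
    ∫⁻ z in offDiagonal a b θ, f z =
      ∫⁻ x, ∫⁻ y in {y | (x, y) ∈ offDiagonal a b θ}, f (x, y) := by
  rw [← lintegral_indicator (measurableSet_offDiagonal a b θ), Measure.volume_eq_prod,
    lintegral_prod _ (hf.indicator (measurableSet_offDiagonal a b θ)).aemeasurable]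
  refine lintegral_congr fun x => ?_
  have hm : MeasurableSet {y | (x, y) ∈ offDiagonal a b θ} :=
    measurable_prodMk_left (measurableSet_offDiagonal a b θ)
  rw [← lintegral_indicator hm]
  rfl

theorem mem_offDiagonal_left {x y : ℝ} (hx : x ∈ Ioo a b) (hy : y ∈ Ioo a x)
    (hθ : θ ∈ Ioo (0 : ℝ) 1) : (x, y) ∈ offDiagonal a b θ ↔ crossRatio a b x y < θ := by
  have h1 : crossRatio a b x y ∈ Ioo (0 : ℝ) 1 := crossRatio_image hx ▸ mem_image_of_mem _ hy
  have hp : 0 < x - a := sub_pos.2 hx.1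
  have hv : 0 < b - y := by linarith [hy.2, hx.2]
  have hr : 0 < y - a := sub_pos.2 hy.1
  have hq : 0 < b - x := sub_pos.2 hx.2
  have h2 := h1.2
  unfold crossRatio at h2 ⊢
  rw [div_lt_one (by positivity)] at h2
  rw [div_lt_iff₀ (by positivity)]
  -- For y < x the ratio is below 1, so the second alternative, asking for a ratio above 1/θ, is
  -- impossible.
  refine ⟨fun h => h.resolve_right ?_, Or.inl⟩
  have : 0 < (y - a) * (b - x) := by positivity
  simp only [not_lt]
  nlinarith [hθ.1, hθ.2]

theorem lintegral_section_groundState (hs : 0 < s) {x : ℝ} (hx : x ∈ Ioo a b)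
    (hθ : θ ∈ Ioo (0 : ℝ) 1) :
    ∫⁻ y in {y | (x, y) ∈ offDiagonal a b θ},
        ENNReal.ofReal (groundState s a b y * gagliardoKernel s x y) =
      ENNReal.ofReal (groundState s a b x * intervalWeight a b x ^ (2 * s)) *
        (2 * ∫⁻ t in Ioo (0 : ℝ) θ, ENNReal.ofReal (radialKernel s t)) := by
  have hm : MeasurableSet {y | (x, y) ∈ offDiagonal a b θ} :=
    measurable_prodMk_left (measurableSet_offDiagonal a b θ)
  have h := lintegral_groundState hs hx (F := (Iio θ).indicator 1)
    (G := {y | (x, y) ∈ offDiagonal a b θ}.indicator 1) (fun y hy => by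
      by_cases h : crossRatio a b x y < θ
      · rw [indicator_of_mem (show crossRatio a b x y ∈ Iio θ from h),
          indicator_of_mem (show y ∈ {y | (x, y) ∈ offDiagonal a b θ} from
            (mem_offDiagonal_left hx hy hθ).2 h)]
        rfl
      · rw [indicator_of_notMem (show crossRatio a b x y ∉ Iio θ from h),
          indicator_of_notMem (show y ∉ {y | (x, y) ∈ offDiagonal a b θ} from
            fun h' => h ((mem_offDiagonal_left hx hy hθ).1 h'))]) (fun y hy => by
      have hy' : y ∈ Ioo a b := ⟨hx.1.trans hy.1, hy.2⟩
      have hx' : x ∈ Ioo a y := ⟨hx.1, hy.1⟩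
      by_cases h : crossRatio a b y x < θ
      · rw [indicator_of_mem (show crossRatio a b y x ∈ Iio θ from h),
          indicator_of_mem (show y ∈ {y | (x, y) ∈ offDiagonal a b θ} from
            swap_mem_offDiagonal.1 ((mem_offDiagonal_left hy' hx' hθ).2 h))]
        rfl
      · rw [indicator_of_notMem (show crossRatio a b y x ∉ Iio θ from h),
          indicator_of_notMem (show y ∉ {y | (x, y) ∈ offDiagonal a b θ} from
            fun h' => h ((mem_offDiagonal_left hy' hx' hθ).1 (swap_mem_offDiagonal.1 h')))])
  have e : Ioo (0 : ℝ) θ = Ioo 0 1 ∩ Iio θ := by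
    ext t
    exact ⟨fun h => ⟨⟨h.1, h.2.trans hθ.2⟩, h.2⟩, fun h => ⟨h.1.1, h.2⟩⟩
  rw [e, inter_comm, ← setLIntegral_indicator measurableSet_Iio, ← lintegral_indicator hm]
  refine Eq.trans (lintegral_congr fun y => ?_) (h.trans ?_)
  · by_cases hy : y ∈ {y | (x, y) ∈ offDiagonal a b θ}
    · simp only [indicator_of_mem hy, Pi.one_apply, mul_one]
    · simp only [indicator_of_notMem hy, mul_zero]
  · congr 2
    refine lintegral_congr fun t => ?_
    by_cases ht : t ∈ Iio θ
    · simp only [indicator_of_mem ht, Pi.one_apply, mul_one]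
    · simp only [indicator_of_notMem ht, mul_zero]

theorem lintegral_eq_setLIntegral_of_groundState (F G : ℝ → ℝ≥0∞)
    (h0 : ∀ x, x ∉ Ioo a b → F x = 0) (h1 : ∀ x ∈ Ioo a b, F x = G x) :
    ∫⁻ x, F x = ∫⁻ x in Ioo a b, G x := by
  rw [← lintegral_indicator measurableSet_Ioo]
  refine lintegral_congr fun x => ?_
  by_cases hx : x ∈ Ioo a b
  · rw [indicator_of_mem hx, h1 x hx]
  · rw [indicator_of_notMem hx, h0 x hx]

theorem groundState_sq_mul_rpow {x : ℝ} (h : ℝ → ℝ) :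
    groundState s a b x * h x ^ 2 * (groundState s a b x * intervalWeight a b x ^ (2 * s)) =
      |groundState s a b x * h x| ^ 2 * intervalWeight a b x ^ (2 * s) := by
  rw [sq_abs]; ring

/-- The ground state representation of the Gagliardo seminorm, away from the diagonal. -/
theorem truncated_groundState_representation (hs : 0 < s) (hθ : θ ∈ Ioo (0 : ℝ) 1) {h : ℝ → ℝ}
    (hh : Measurable h) :
    gagliardoEnergy s (offDiagonal a b θ) (fun x => groundState s a b x * h x) +
        4 * (∫⁻ t in Ioo (0 : ℝ) θ, ENNReal.ofReal (radialKernel s t)) *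
          weightedMass s a b (fun x => groundState s a b x * h x) =
      groundEnergy s a b (offDiagonal a b θ) h +
        ∫⁻ x in Ioo a b, ENNReal.ofReal (|groundState s a b x * h x| ^ 2 *
          (2 * sectionMass s a b θ x)) := by
  set w := groundState s a b with hw
  set R := offDiagonal a b θ with hR
  have mw : Measurable w := measurable_groundState s a b
  have mk := measurable_gagliardoKernel s
  have w0 : ∀ x, 0 ≤ w x := groundState_nonneg s a b
  have k0 : ∀ x y, 0 ≤ gagliardoKernel s x y := gagliardoKernel_nonneg s
  have m1 : Measurable fun z : ℝ × ℝ =>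
      ENNReal.ofReal (w z.1 * h z.1 ^ 2 * (w z.2 * gagliardoKernel s z.1 z.2)) := by fun_prop
  have m2 : Measurable fun z : ℝ × ℝ =>
      ENNReal.ofReal ((w z.1 * h z.1) ^ 2 * gagliardoKernel s z.1 z.2) := by fun_prop
  have m3 : Measurable fun z : ℝ × ℝ =>
      ENNReal.ofReal ((w z.1 * h z.1 - w z.2 * h z.2) ^ 2 * gagliardoKernel s z.1 z.2) := by
    fun_prop
  have m4 : Measurable fun z : ℝ × ℝ =>
      ENNReal.ofReal (w z.1 * w z.2 * (h z.1 - h z.2) ^ 2 * gagliardoKernel s z.1 z.2) := by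
    fun_prop
  have I1 : ∫⁻ z in R, ENNReal.ofReal (w z.1 * h z.1 ^ 2 * (w z.2 * gagliardoKernel s z.1 z.2)) =
      2 * (∫⁻ t in Ioo (0 : ℝ) θ, ENNReal.ofReal (radialKernel s t)) *
        weightedMass s a b (fun x => w x * h x) := by
    rw [hR, setLIntegral_offDiagonal_prod m1, weightedMass, ← lintegral_const_mul]
    · refine lintegral_eq_setLIntegral_of_groundState _ _ (fun x hx => ?_) (fun x hx => ?_)
      · simp only [hw, groundState_of_notMem hx, zero_mul, ENNReal.ofReal_zero, lintegral_zero]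
      · simp only [ENNReal.ofReal_mul (mul_nonneg (w0 x) (sq_nonneg (h x)))]
        rw [lintegral_const_mul' _ _ ENNReal.ofReal_ne_top,
          lintegral_section_groundState hs hx hθ, ← mul_assoc,
          ← ENNReal.ofReal_mul (mul_nonneg (w0 x) (sq_nonneg (h x))), hw,
          groundState_sq_mul_rpow h]
        ring
    · have := measurable_intervalWeight a b
      fun_prop
  have I2 : ∫⁻ z in R, ENNReal.ofReal ((w z.1 * h z.1) ^ 2 * gagliardoKernel s z.1 z.2) =
      ∫⁻ x in Ioo a b, ENNReal.ofReal (|w x * h x| ^ 2 * sectionMass s a b θ x) := by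
    rw [hR, setLIntegral_offDiagonal_prod m2]
    refine lintegral_eq_setLIntegral_of_groundState _ _ (fun x hx => ?_) (fun x hx => ?_)
    · simp [hw, groundState_of_notMem hx]
    · simp only [ENNReal.ofReal_mul (sq_nonneg (w x * h x)), sq_abs]
      rw [lintegral_const_mul' _ _ ENNReal.ofReal_ne_top, lintegral_section hs hx hθ]
  have S1 := setLIntegral_offDiagonal_swap (a := a) (b := b) (θ := θ) fun z : ℝ × ℝ =>
      ENNReal.ofReal (w z.1 * h z.1 ^ 2 * (w z.2 * gagliardoKernel s z.1 z.2))
  have S2 := setLIntegral_offDiagonal_swap (a := a) (b := b) (θ := θ) fun z : ℝ × ℝ =>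
      ENNReal.ofReal ((w z.1 * h z.1) ^ 2 * gagliardoKernel s z.1 z.2)
  -- The expansion of squares, with terms distributed so that all are nonnegative and nothing is
  -- subtracted in [0, ∞].
  have P : ∀ z : ℝ × ℝ,
      ENNReal.ofReal ((w z.1 * h z.1 - w z.2 * h z.2) ^ 2 * gagliardoKernel s z.1 z.2) +
      (ENNReal.ofReal (w z.1 * h z.1 ^ 2 * (w z.2 * gagliardoKernel s z.1 z.2)) +
      ENNReal.ofReal (w z.2 * h z.2 ^ 2 * (w z.1 * gagliardoKernel s z.2 z.1))) =
      ENNReal.ofReal (w z.1 * w z.2 * (h z.1 - h z.2) ^ 2 * gagliardoKernel s z.1 z.2) +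
      (ENNReal.ofReal ((w z.1 * h z.1) ^ 2 * gagliardoKernel s z.1 z.2) +
      ENNReal.ofReal ((w z.2 * h z.2) ^ 2 * gagliardoKernel s z.2 z.1)) := by
    intro z
    rw [gagliardoKernel_comm s z.2 z.1]
    have a1 := w0 z.1
    have a2 := w0 z.2
    have a3 := k0 z.1 z.2
    rw [← ENNReal.ofReal_add (by positivity) (by positivity),
      ← ENNReal.ofReal_add (by positivity) (by positivity),
      ← ENNReal.ofReal_add (by positivity) (by positivity),
      ← ENNReal.ofReal_add (by positivity) (by positivity)]
    congr 1
    ring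
  have main := lintegral_congr (μ := volume.restrict R) P
  rw [lintegral_add_left m3, lintegral_add_left m1, lintegral_add_left m4,
    lintegral_add_left m2] at main
  simp only [Prod.fst_swap, Prod.snd_swap] at S1 S2
  rw [S1, S2, I1, I2] at main
  have e2 : ∫⁻ x in Ioo a b, ENNReal.ofReal (|w x * h x| ^ 2 * (2 * sectionMass s a b θ x)) =
      (∫⁻ x in Ioo a b, ENNReal.ofReal (|w x * h x| ^ 2 * sectionMass s a b θ x)) +
      ∫⁻ x in Ioo a b, ENNReal.ofReal (|w x * h x| ^ 2 * sectionMass s a b θ x) := by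
    rw [← two_mul, ← lintegral_const_mul' _ _ (by simp)]
    refine lintegral_congr fun x => ?_
    rw [mul_left_comm, ENNReal.ofReal_mul (by norm_num), ENNReal.ofReal_ofNat]
  rw [e2]
  refine Eq.trans ?_ main
  unfold gagliardoEnergy
  ring

end Identity

/-! ### Removing the cutoff. -/

/-- A sequence in `[1 / 2, 1)` converging to one. -/
noncomputable def thetaSeq (n : ℕ) : ℝ := 1 - 1 / ((n : ℝ) + 2)

theorem thetaSeq_mem (n : ℕ) : thetaSeq n ∈ Ico (1 / 2 : ℝ) 1 := by
  have h : (0 : ℝ) ≤ n := n.cast_nonneg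
  unfold thetaSeq
  constructor
  · have : 1 / ((n : ℝ) + 2) ≤ 1 / 2 := one_div_le_one_div_of_le (by norm_num) (by linarith)
    linarith
  · have : 0 < 1 / ((n : ℝ) + 2) := by positivity
    linarith

theorem monotone_thetaSeq : Monotone thetaSeq := by
  intro m n hmn
  have h : (0 : ℝ) ≤ m := m.cast_nonneg
  have h' : (m : ℝ) ≤ n := Nat.cast_le.2 hmn
  unfold thetaSeq
  have : 1 / ((n : ℝ) + 2) ≤ 1 / ((m : ℝ) + 2) :=
    one_div_le_one_div_of_le (by linarith) (by linarith)
  linarith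

theorem tendsto_thetaSeq : Filter.Tendsto thetaSeq Filter.atTop (nhds 1) := by
  have h1 : Filter.Tendsto (fun n : ℕ => (n : ℝ) + 2) Filter.atTop Filter.atTop :=
    Filter.tendsto_atTop_add_const_right _ _ tendsto_natCast_atTop_atTop
  have h2 := (tendsto_const_nhds (x := (1 : ℝ))).sub (h1.const_div_atTop 1)
  rw [sub_zero] at h2
  exact h2

/-- The error in the truncated ground state representation. -/
noncomputable def truncationError (s θ : ℝ) : ℝ := 48 / s * (1 - θ) ^ (2 - 2 * s)

theorem truncationError_nonneg {s θ : ℝ} (hs : 0 < s) (hθ : θ < 1) : 0 ≤ truncationError s θ :=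
  mul_nonneg (by positivity) (Real.rpow_nonneg (by linarith) _)

theorem tendsto_truncationError {s : ℝ} (hs1 : s < 1) :
    Filter.Tendsto (fun n => ENNReal.ofReal (truncationError s (thetaSeq n))) Filter.atTop
      (nhds 0) := by
  have h1 : Filter.Tendsto (fun n => 1 - thetaSeq n) Filter.atTop (nhds 0) := by
    simpa using (tendsto_const_nhds (x := (1 : ℝ))).sub tendsto_thetaSeq
  have h2 := (h1.rpow_const (p := 2 - 2 * s) (Or.inr (by linarith))).const_mul (48 / s)
  rw [Real.zero_rpow (by linarith), mul_zero] at h2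
  simpa [truncationError] using ENNReal.tendsto_ofReal h2

/-- The sharp constant with the integral cut off near the singularity. -/
noncomputable def truncatedConstant (s θ : ℝ) : ℝ≥0∞ :=
  2 * (∫⁻ t in Ioo 0 θ, ENNReal.ofReal (sharpIntegrand s t)) + ENNReal.ofReal (1 / s)

theorem truncatedConstant_le {s θ : ℝ} (hθ : θ ≤ 1) : truncatedConstant s θ ≤ sharpConstant s 2 := by
  rw [sharpConstant_two]
  unfold truncatedConstant
  gcongr

theorem tendsto_truncatedConstant (s : ℝ) :
    Filter.Tendsto (fun n => truncatedConstant s (thetaSeq n)) Filter.atTop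
      (nhds (sharpConstant s 2)) := by
  have hmono : Monotone fun n => Ioo 0 (thetaSeq n) := fun m n h =>
    Ioo_subset_Ioo_right (monotone_thetaSeq h)
  have hU : ⋃ n, Ioo 0 (thetaSeq n) = Ioo (0 : ℝ) 1 := by
    ext t
    simp only [mem_iUnion]
    constructor
    · rintro ⟨n, h⟩
      exact ⟨h.1, h.2.trans (thetaSeq_mem n).2⟩
    · intro h
      obtain ⟨n, hn⟩ := (tendsto_thetaSeq.eventually (lt_mem_nhds h.2)).exists
      exact ⟨n, h.1, hn⟩
  have h1 : Filter.Tendsto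
      (fun n => ∫⁻ t in Ioo 0 (thetaSeq n), ENNReal.ofReal (sharpIntegrand s t)) Filter.atTop
      (nhds (∫⁻ t in Ioo (0 : ℝ) 1, ENNReal.ofReal (sharpIntegrand s t))) := by
    rw [← hU, setLIntegral_iUnion_of_directed _ hmono.directed_le]
    exact tendsto_atTop_iSup fun m n h => lintegral_mono_set (hmono h)
  rw [sharpConstant_two]
  exact (ENNReal.Tendsto.const_mul h1 (Or.inr (by simp))).add_const _

section Limits

variable {s a b : ℝ}

theorem lintegral_radialKernel_ne_top (hs : 0 < s) {θ : ℝ} (hθ : θ ∈ Ioo (0 : ℝ) 1) :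
    4 * ∫⁻ t in Ioo 0 θ, ENNReal.ofReal (radialKernel s t) ≠ ⊤ := by
  refine ne_top_of_le_ne_top ENNReal.ofReal_ne_top
    (le_trans ?_ (truncated_sharpConstant hs hθ).le)
  exact le_add_self

theorem lintegral_weight_mul (f : ℝ → ℝ) {c : ℝ} (hc : 0 ≤ c) :
    ∫⁻ x in Ioo a b, ENNReal.ofReal (|f x| ^ 2 * (intervalWeight a b x ^ (2 * s) * c)) =
      ENNReal.ofReal c * weightedMass s a b f := by
  unfold weightedMass
  rw [← lintegral_const_mul' _ _ ENNReal.ofReal_ne_top]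
  refine lintegral_congr fun x => ?_
  rw [← ENNReal.ofReal_mul hc]
  congr 1
  ring

/-- The divergent contribution of the radial kernel appears on both sides and cancels, since it is
finite for fixed θ and finite mass. The first bound discards the ground energy; the second keeps it
for use in the optimality argument. -/
theorem truncated_bounds (hs0 : 0 < s) (hs1 : s < 1) {θ : ℝ} (hθ : θ ∈ Ico (1 / 2 : ℝ) 1)
    {h : ℝ → ℝ} (hh : Measurable h)
    (hfin : weightedMass s a b (fun x => groundState s a b x * h x) < ⊤) :
    truncatedConstant s θ * weightedMass s a b (fun x => groundState s a b x * h x) ≤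
        gagliardoEnergy s (offDiagonal a b θ) (fun x => groundState s a b x * h x) +
          ENNReal.ofReal (truncationError s θ) *
            weightedMass s a b (fun x => groundState s a b x * h x) ∧
      gagliardoEnergy s (offDiagonal a b θ) (fun x => groundState s a b x * h x) ≤
        groundEnergy s a b (offDiagonal a b θ) h +
          (truncatedConstant s θ + ENNReal.ofReal (truncationError s θ)) *
            weightedMass s a b (fun x => groundState s a b x * h x) := by
  have hθ' : θ ∈ Ioo (0 : ℝ) 1 := ⟨by linarith [hθ.1], hθ.2⟩
  have key := truncated_groundState_representation (a := a) (b := b) hs0 hθ' hh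
  have hJ := truncated_sharpConstant hs0 hθ'
  have hB := lintegral_radialKernel_ne_top hs0 hθ'
  set u : ℝ → ℝ := fun x => groundState s a b x * h x
  set M : ℝ := (1 / s) * ((1 + θ ^ (2 * s)) * (1 - θ) ^ (-(2 * s)))
  have hM : 0 ≤ M := by
    have := hθ'.1
    have : 0 < 1 - θ := sub_pos.2 hθ'.2
    positivity
  have hδ := truncationError_nonneg hs0 hθ'.2
  have mu : Measurable u := (measurable_groundState s a b).mul hh
  have mw := measurable_intervalWeight a b
  set B : ℝ≥0∞ := 4 * ∫⁻ t in Ioo 0 θ, ENNReal.ofReal (radialKernel s t)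
  set H := weightedMass s a b u
  change truncatedConstant s θ + B = _ at hJ
  have hBH : B * H ≠ ⊤ := ENNReal.mul_ne_top hB hfin.ne
  have w0 : ∀ x ∈ Ioo a b, 0 ≤ intervalWeight a b x ^ (2 * s) := fun x hx =>
    Real.rpow_nonneg (intervalWeight_pos hx).le _
  have b1 : ENNReal.ofReal M * H ≤
      (∫⁻ x in Ioo a b, ENNReal.ofReal (|u x| ^ 2 * (2 * sectionMass s a b θ x))) +
        ENNReal.ofReal (truncationError s θ) * H := by
    rw [← lintegral_weight_mul u hM, ← lintegral_weight_mul u hδ, ← lintegral_add_right _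
      (by fun_prop)]
    refine setLIntegral_mono' measurableSet_Ioo fun x hx => ?_
    refine le_trans (ENNReal.ofReal_le_ofReal ?_) ENNReal.ofReal_add_le
    rw [← mul_add]
    have := (abs_le.1 (abs_sectionMass_sub_le hs0 hs1 hx hθ)).1
    gcongr
    unfold truncationError
    linarith
  have b2 : (∫⁻ x in Ioo a b, ENNReal.ofReal (|u x| ^ 2 * (2 * sectionMass s a b θ x))) ≤
      ENNReal.ofReal M * H + ENNReal.ofReal (truncationError s θ) * H := by
    rw [← lintegral_weight_mul u hM, ← lintegral_weight_mul u hδ, ← lintegral_add_right _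
      (by fun_prop)]
    refine setLIntegral_mono' measurableSet_Ioo fun x hx => ?_
    have := w0 x hx
    rw [← ENNReal.ofReal_add (by positivity) (by positivity)]
    refine ENNReal.ofReal_le_ofReal ?_
    rw [← mul_add]
    have := (abs_le.1 (abs_sectionMass_sub_le hs0 hs1 hx hθ)).2
    gcongr
    unfold truncationError
    linarith
  rw [← hJ] at b1 b2
  constructor
  · refine (ENNReal.add_le_add_iff_right hBH).1 ?_
    calc truncatedConstant s θ * H + B * H = (truncatedConstant s θ + B) * H := by ring
      _ ≤ _ := b1
      _ ≤ (groundEnergy s a b (offDiagonal a b θ) h +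
          ∫⁻ x in Ioo a b, ENNReal.ofReal (|u x| ^ 2 * (2 * sectionMass s a b θ x))) +
          ENNReal.ofReal (truncationError s θ) * H := by gcongr; exact le_add_self
      _ = _ := by rw [← key]; ring
  · refine (ENNReal.add_le_add_iff_right hBH).1 ?_
    rw [key]
    calc _ ≤ groundEnergy s a b (offDiagonal a b θ) h + ((truncatedConstant s θ + B) * H +
          ENNReal.ofReal (truncationError s θ) * H) := by gcongr
      _ = _ := by ring

theorem gagliardoEnergy_mono {R S : Set (ℝ × ℝ)} (h : R ⊆ S) (u : ℝ → ℝ) :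
    gagliardoEnergy s R u ≤ gagliardoEnergy s S u := lintegral_mono_set h

/-- The weighted fractional Hardy inequality, for functions with finite weighted mass. -/
theorem sharpConstant_mul_weightedMass_le (hs0 : 0 < s) (hs1 : s < 1) {h : ℝ → ℝ}
    (hh : Measurable h)
    (hfin : weightedMass s a b (fun x => groundState s a b x * h x) < ⊤) :
    sharpConstant s 2 * weightedMass s a b (fun x => groundState s a b x * h x) ≤
      gagliardoEnergy s univ (fun x => groundState s a b x * h x) := by
  have t1 := ENNReal.Tendsto.mul_const (tendsto_truncatedConstant s)
    (Or.inr hfin.ne)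
  have t2 := (ENNReal.Tendsto.mul_const (tendsto_truncationError hs1) (Or.inr hfin.ne)).const_add
    (gagliardoEnergy s univ (fun x => groundState s a b x * h x))
  rw [zero_mul, add_zero] at t2
  refine le_of_tendsto_of_tendsto' t1 t2 fun n => ?_
  refine (truncated_bounds hs0 hs1 (thetaSeq_mem n) hh hfin).1.trans ?_
  gcongr
  exact gagliardoEnergy_mono (subset_univ _) _

/-- The two products compared differ by (b-a)(y-x), so they agree only on the diagonal. This holds
for all real pairs, whatever the signs of the products. -/
theorem eventually_mem_offDiagonal (hab : a < b) {z : ℝ × ℝ} (hz : z.1 ≠ z.2) :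
    ∀ᶠ n in Filter.atTop, z ∈ offDiagonal a b (thetaSeq n) := by
  have hne : (z.2 - a) * (b - z.1) ≠ (z.1 - a) * (b - z.2) := by
    intro h
    have h1 : (b - a) * (z.2 - z.1) = 0 := by linarith
    rcases mul_eq_zero.1 h1 with h2 | h2
    · linarith
    · exact hz (by linarith)
  rcases lt_or_gt_of_ne hne with h | h
  · have t := tendsto_thetaSeq.mul_const ((z.1 - a) * (b - z.2))
    rw [one_mul] at t
    exact (t.eventually (lt_mem_nhds h)).mono fun n hn => Or.inl hn
  · have t := tendsto_thetaSeq.mul_const ((z.2 - a) * (b - z.1))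
    rw [one_mul] at t
    exact (t.eventually (lt_mem_nhds h)).mono fun n hn => Or.inr hn

theorem gagliardoEnergy_univ_le_liminf (hab : a < b) {u : ℝ → ℝ} (hu : Measurable u) :
    gagliardoEnergy s univ u ≤
      Filter.liminf (fun n => gagliardoEnergy s (offDiagonal a b (thetaSeq n)) u) Filter.atTop := by
  have mk := measurable_gagliardoKernel s
  have mf : Measurable fun z : ℝ × ℝ =>
      ENNReal.ofReal ((u z.1 - u z.2) ^ 2 * gagliardoKernel s z.1 z.2) := by fun_prop
  unfold gagliardoEnergy
  simp only [Measure.restrict_univ, ← lintegral_indicator (measurableSet_offDiagonal a b _)]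
  refine le_trans (lintegral_mono fun z => ?_)
    (lintegral_liminf_le fun n => mf.indicator (measurableSet_offDiagonal a b (thetaSeq n)))
  by_cases hz : z.1 = z.2
  · simp [hz]
  · refine Filter.le_liminf_of_le (by isBoundedDefault) ?_
    filter_upwards [eventually_mem_offDiagonal hab hz] with n hn
    rw [indicator_of_mem hn]

theorem gagliardoEnergy_le (hs0 : 0 < s) (hs1 : s < 1) (hab : a < b) {h : ℝ → ℝ}
    (hh : Measurable h)
    (hfin : weightedMass s a b (fun x => groundState s a b x * h x) < ⊤) :
    gagliardoEnergy s univ (fun x => groundState s a b x * h x) ≤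
      groundEnergy s a b univ h +
        sharpConstant s 2 * weightedMass s a b (fun x => groundState s a b x * h x) := by
  have t1 := (ENNReal.Tendsto.mul_const ((tendsto_truncationError hs1).const_add
    (sharpConstant s 2)) (Or.inr hfin.ne)).const_add (groundEnergy s a b univ h)
  rw [add_zero] at t1
  rw [← t1.liminf_eq]
  refine (gagliardoEnergy_univ_le_liminf hab
    ((measurable_groundState s a b).mul hh)).trans ?_
  refine Filter.liminf_le_liminf (Filter.Eventually.of_forall fun n => ?_)
    (by isBoundedDefault) (by isBoundedDefault)
  refine (truncated_bounds hs0 hs1 (thetaSeq_mem n) hh hfin).2.trans ?_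
  have h1 := truncatedConstant_le (s := s) (thetaSeq_mem n).2.le
  have h2 : groundEnergy s a b (offDiagonal a b (thetaSeq n)) h ≤ groundEnergy s a b univ h :=
    lintegral_mono_set (subset_univ _)
  gcongr

end Limits

/-! ### The Hardy inequality for test functions. -/

section TestFunctions

variable {s a b : ℝ}

theorem eq_groundState_mul {u : ℝ → ℝ} (hu : ∀ x, x ∉ Ioo a b → u x = 0) :
    u = fun x => groundState s a b x * (u x / groundState s a b x) := by
  funext x
  by_cases hx : x ∈ Ioo a b
  · rw [mul_div_cancel₀ _ (groundState_pos hx).ne']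
  · rw [hu x hx, zero_div, mul_zero]

theorem IsTestFunction.eq_zero {u : ℝ → ℝ} {Ω : Set ℝ} (hu : IsTestFunction Ω u) {x : ℝ}
    (hx : x ∉ Ω) : u x = 0 :=
  image_eq_zero_of_notMem_tsupport fun h => hx (hu.2.2 h)

theorem IsTestFunction.weightedMass_lt_top {u : ℝ → ℝ} (hu : IsTestFunction (Ioo a b) u) :
    weightedMass s a b u < ⊤ := by
  have hK : IsCompact (tsupport u) := hu.2.1
  have hc : ContinuousOn (fun t => |u t| ^ 2 * intervalWeight a b t ^ (2 * s)) (tsupport u) := by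
    refine (hu.1.continuous.abs.pow 2).continuousOn.mul ?_
    refine ContinuousOn.rpow_const ?_ fun x hx => Or.inl (intervalWeight_pos (hu.2.2 hx)).ne'
    unfold intervalWeight
    refine ContinuousOn.add ?_ ?_
    · exact continuousOn_const.div (by fun_prop) fun x hx => (sub_pos.2 (hu.2.2 hx).1).ne'
    · exact continuousOn_const.div (by fun_prop) fun x hx => (sub_pos.2 (hu.2.2 hx).2).ne'
  have hi := (hc.integrableOn_compact (μ := volume) hK).lintegral_lt_top
  refine lt_of_le_of_lt ?_ hi
  unfold weightedMass
  rw [← lintegral_indicator measurableSet_Ioo, ← lintegral_indicator hK.measurableSet]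
  refine lintegral_mono fun x => ?_
  by_cases hx : x ∈ tsupport u
  · rw [indicator_of_mem hx, indicator_of_mem (hu.2.2 hx)]
  · by_cases hx' : x ∈ Ioo a b
    · rw [indicator_of_mem hx', image_eq_zero_of_notMem_tsupport hx]
      simp
    · rw [indicator_of_notMem hx']
      exact zero_le

theorem IsTestFunction.hardy_inequality {u : ℝ → ℝ} (hs0 : 0 < s) (hs1 : s < 1)
    (hu : IsTestFunction (Ioo a b) u) :
    sharpConstant s 2 * weightedMass s a b u ≤ gagliardoSeminorm s 2 u ^ 2 := by
  rw [gagliardoSeminorm_sq]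
  have e : u = _ := eq_groundState_mul (s := s) fun x hx => hu.eq_zero hx
  have hm : Measurable fun x => u x / groundState s a b x :=
    hu.1.continuous.measurable.div (measurable_groundState s a b)
  have hfin : weightedMass s a b u < ⊤ := hu.weightedMass_lt_top
  rw [e] at hfin ⊢
  exact sharpConstant_mul_weightedMass_le hs0 hs1 hm hfin

end TestFunctions

/-! ### Passage to the closure. -/

section Density

variable {s a b : ℝ}

/-- Exhibits the seminorm as an L^2 norm of the difference times the root of the kernel, so that
Minkowski's inequality applies. -/
theorem gagliardoSeminorm_two (s : ℝ) (u : ℝ → ℝ) :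
    gagliardoSeminorm s 2 u = (∫⁻ z : ℝ × ℝ, ENNReal.ofReal
      (|u z.1 - u z.2| * gagliardoKernel s z.1 z.2 ^ (1 / 2 : ℝ)) ^ (2 : ℝ)) ^ (1 / 2 : ℝ) := by
  unfold gagliardoSeminorm
  congr 1
  refine lintegral_congr fun z => ?_
  have hk := gagliardoKernel_nonneg s z.1 z.2
  rw [ENNReal.ofReal_rpow_of_nonneg (by positivity) (by norm_num),
    Real.mul_rpow (abs_nonneg _) (by positivity), ← Real.rpow_mul hk]
  norm_num
  rw [div_eq_mul_inv]
  rfl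

theorem gagliardoSeminorm_le_add {u v : ℝ → ℝ} (hu : AEMeasurable u) (hv : AEMeasurable v) :
    gagliardoSeminorm s 2 v ≤ gagliardoSeminorm s 2 u + gagliardoSeminorm s 2 (u - v) := by
  have mk := measurable_gagliardoKernel s
  have m : ∀ {f : ℝ → ℝ}, AEMeasurable f → AEMeasurable (fun z : ℝ × ℝ => ENNReal.ofReal
      (|f z.1 - f z.2| * gagliardoKernel s z.1 z.2 ^ (1 / 2 : ℝ))) := by
    intro f hf
    have h1 : AEMeasurable (fun z : ℝ × ℝ => f z.1) :=
      hf.comp_quasiMeasurePreserving Measure.quasiMeasurePreserving_fst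
    have h2 : AEMeasurable (fun z : ℝ × ℝ => f z.2) :=
      hf.comp_quasiMeasurePreserving Measure.quasiMeasurePreserving_snd
    have h3 : AEMeasurable (fun z : ℝ × ℝ => |f z.1 - f z.2|) := (h1.sub h2).abs
    fun_prop
  simp only [gagliardoSeminorm_two]
  refine le_trans ?_ (ENNReal.lintegral_Lp_add_le (p := 2) (m hu) (m (hu.sub hv)) (by norm_num))
  gcongr with z
  simp only [Pi.add_apply, Pi.sub_apply]
  have hk := gagliardoKernel_nonneg s z.1 z.2
  rw [← ENNReal.ofReal_add (by positivity) (by positivity), ← add_mul]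
  refine ENNReal.ofReal_le_ofReal (mul_le_mul_of_nonneg_right ?_ (by positivity))
  have : v z.1 - v z.2 = (u z.1 - u z.2) - (u z.1 - v z.1 - (u z.2 - v z.2)) := by ring
  rw [this]
  exact abs_sub _ _

theorem sharpConstant_ne_zero (hs : 0 < s) : sharpConstant s 2 ≠ 0 := by
  rw [sharpConstant_two]
  have : 0 < ENNReal.ofReal (1 / s) := ENNReal.ofReal_pos.2 (by positivity)
  exact (lt_of_lt_of_le this le_add_self).ne'

/-- Lower semicontinuity of the weighted integral along sequences converging almost
everywhere. -/
theorem weightedMass_le_liminf {u : ℝ → ℝ} {φ : ℕ → ℝ → ℝ} (hφ : ∀ n, Measurable (φ n))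
    (h : ∀ᵐ x, Filter.Tendsto (fun n => φ n x) Filter.atTop (nhds (u x))) :
    weightedMass s a b u ≤ Filter.liminf (fun n => weightedMass s a b (φ n)) Filter.atTop := by
  have mw := measurable_intervalWeight a b
  unfold weightedMass
  refine le_trans (lintegral_mono_ae ((ae_restrict_of_ae h).mono fun x hx => ?_))
    (lintegral_liminf_le fun n => by have := hφ n; fun_prop)
  exact (ENNReal.tendsto_ofReal ((hx.abs.pow 2).mul_const _)).liminf_eq.ge

/-- The weighted fractional Hardy inequality on the closure of the test functions. -/
theorem MemSobolevTildeZero.hardy_inequality (hs0 : 0 < s) (hs1 : s < 1) {u : ℝ → ℝ}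
    (hu : MemSobolevTildeZero s 2 (Ioo a b) u) :
    sharpConstant s 2 * weightedMass s a b u ≤ gagliardoSeminorm s 2 u ^ 2 := by
  have hpos : ∀ n : ℕ, (0 : ℝ≥0∞) < ((n : ℝ≥0∞) + 1)⁻¹ := fun n =>
    ENNReal.inv_pos.2 (by simp)
  choose φ hφ hφu using fun n : ℕ => hu.2 _ (hpos n)
  have hm : ∀ n, Measurable (φ n) := fun n => (hφ n).1.continuous.measurable
  have hum : AEStronglyMeasurable u volume := hu.1.1.1
  have hε : Filter.Tendsto (fun n : ℕ => ((n : ℝ≥0∞) + 1)⁻¹) Filter.atTop (nhds 0) := by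
    have := (Filter.tendsto_add_atTop_iff_nat 1).2 ENNReal.tendsto_inv_nat_nhds_zero
    simpa using this
  have hL : Filter.Tendsto (fun n => eLpNorm (φ n - u) 2 volume) Filter.atTop (nhds 0) := by
    refine tendsto_of_tendsto_of_tendsto_of_le_of_le tendsto_const_nhds hε
      (fun n => zero_le) fun n => ?_
    rw [eLpNorm_sub_comm]
    refine le_trans ?_ (hφu n).le
    unfold sobolevNorm
    rw [ENNReal.ofReal_ofNat]
    exact le_self_add
  -- L^2 convergence yields an almost everywhere convergent subsequence: Fatou's lemma then handles
  -- the weighted mass, and the triangle inequality the seminorms.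
  obtain ⟨ns, hns, hae⟩ := (tendstoInMeasure_of_tendsto_eLpNorm (by norm_num)
    (fun n => (hm n).aestronglyMeasurable) hum hL).exists_seq_tendsto_ae
  have h1 := weightedMass_le_liminf (s := s) (a := a) (b := b) (fun n => hm (ns n)) hae
  have hb : ∀ n, weightedMass s a b (φ (ns n)) ≤
      (gagliardoSeminorm s 2 u + ((ns n : ℝ≥0∞) + 1)⁻¹) ^ 2 / sharpConstant s 2 := by
    intro n
    rw [ENNReal.le_div_iff_mul_le (Or.inl (sharpConstant_ne_zero hs0))
      (Or.inl (sharpConstant_lt_top hs0 hs1).ne), mul_comm]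
    refine ((hφ (ns n)).hardy_inequality hs0 hs1).trans ?_
    gcongr
    refine (gagliardoSeminorm_le_add hum.aemeasurable (hm (ns n)).aemeasurable).trans ?_
    gcongr
    exact le_trans le_add_self (hφu (ns n)).le
  have ht : Filter.Tendsto (fun n => (gagliardoSeminorm s 2 u + ((ns n : ℝ≥0∞) + 1)⁻¹) ^ 2 /
      sharpConstant s 2) Filter.atTop (nhds (gagliardoSeminorm s 2 u ^ 2 / sharpConstant s 2)) := by
    have t1 := (hε.comp hns.tendsto_atTop).const_add (gagliardoSeminorm s 2 u)
    rw [add_zero] at t1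
    exact ENNReal.Tendsto.div_const (((ENNReal.continuous_pow 2).tendsto _).comp t1)
      (Or.inr (sharpConstant_ne_zero hs0))
  have h2 : weightedMass s a b u ≤ gagliardoSeminorm s 2 u ^ 2 / sharpConstant s 2 := by
    rw [← ht.liminf_eq]
    exact h1.trans (Filter.liminf_le_liminf (Filter.Eventually.of_forall hb)
      (by isBoundedDefault) (by isBoundedDefault))
  rwa [ENNReal.le_div_iff_mul_le (Or.inl (sharpConstant_ne_zero hs0))
      (Or.inl (sharpConstant_lt_top hs0 hs1).ne), mul_comm] at h2

end Density

/-! ### Comparison with the boundary distance, and non-attainment. -/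

section Distance

variable {s a b : ℝ}

theorem boundaryDist_Ioo {t : ℝ} (ht : t ∈ Ioo a b) :
    boundaryDist (Ioo a b) t = min (t - a) (b - t) := by
  have hab : a < b := ht.1.trans ht.2
  unfold boundaryDist
  rw [frontier_Ioo hab, Metric.infDist, insert_eq, Metric.infEDist_union,
    Metric.infEDist_singleton, Metric.infEDist_singleton, edist_dist, edist_dist,
    ← ENNReal.ofReal_min, ENNReal.toReal_ofReal (le_min dist_nonneg dist_nonneg)]
  rw [Real.dist_eq, Real.dist_eq, abs_of_pos (sub_pos.2 ht.1), abs_sub_comm,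
    abs_of_pos (sub_pos.2 ht.2)]

theorem boundaryDist_Ioo_pos {t : ℝ} (ht : t ∈ Ioo a b) : 0 < boundaryDist (Ioo a b) t := by
  rw [boundaryDist_Ioo ht]
  exact lt_min (sub_pos.2 ht.1) (sub_pos.2 ht.2)

theorem inv_boundaryDist_lt {t : ℝ} (ht : t ∈ Ioo a b) :
    (boundaryDist (Ioo a b) t)⁻¹ < intervalWeight a b t := by
  have h1 : 0 < t - a := sub_pos.2 ht.1
  have h2 : 0 < b - t := sub_pos.2 ht.2
  rw [boundaryDist_Ioo ht]
  unfold intervalWeight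
  have h3 : 0 < 1 / (t - a) := by positivity
  have h4 : 0 < 1 / (b - t) := by positivity
  rcases min_choice (t - a) (b - t) with h | h <;> rw [h, ← one_div] <;> linarith

theorem hardyIntegrand_eq {t : ℝ} (ht : t ∈ Ioo a b) (u : ℝ → ℝ) :
    |u t| ^ (2 : ℝ) / boundaryDist (Ioo a b) t ^ (s * 2) =
      |u t| ^ 2 * (boundaryDist (Ioo a b) t)⁻¹ ^ (2 * s) := by
  rw [Real.inv_rpow (boundaryDist_Ioo_pos ht).le, Real.rpow_two, mul_comm s 2, div_eq_mul_inv]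

theorem inv_boundaryDist_rpow_lt (hs : 0 < s) {t : ℝ} (ht : t ∈ Ioo a b) :
    (boundaryDist (Ioo a b) t)⁻¹ ^ (2 * s) < intervalWeight a b t ^ (2 * s) :=
  Real.rpow_lt_rpow (inv_nonneg.2 (boundaryDist_Ioo_pos ht).le) (inv_boundaryDist_lt ht)
    (by linarith)

theorem hardyIntegral_le_weightedMass (hs : 0 < s) (u : ℝ → ℝ) :
    hardyIntegral s 2 (Ioo a b) u ≤ weightedMass s a b u := by
  refine setLIntegral_mono' measurableSet_Ioo fun t ht => ENNReal.ofReal_le_ofReal ?_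
  rw [hardyIntegrand_eq ht]
  exact mul_le_mul_of_nonneg_left (inv_boundaryDist_rpow_lt hs ht).le (by positivity)

theorem sharpConstant_le_hardyConstant (hs0 : 0 < s) (hs1 : s < 1) :
    sharpConstant s 2 ≤ hardyConstant s 2 (Ioo a b) := by
  unfold hardyConstant
  refine le_iInf fun u => le_iInf fun hu => le_iInf fun h1 => ?_
  rw [ENNReal.rpow_two]
  refine le_trans ?_ (hu.hardy_inequality hs0 hs1)
  exact le_mul_of_one_le_right zero_le (h1 ▸ hardyIntegral_le_weightedMass hs0 u)

/-- Equal finite integrals of ordered integrands would force equality almost everywhere. As the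
weights differ strictly, u would vanish almost everywhere on the interval, against the
normalization. -/
theorem hardyIntegral_lt_weightedMass (hs : 0 < s) {u : ℝ → ℝ} (hu : AEMeasurable u)
    (h1 : hardyIntegral s 2 (Ioo a b) u = 1) : 1 < weightedMass s a b u := by
  have mw := measurable_intervalWeight a b
  refine lt_of_le_of_ne (h1 ▸ hardyIntegral_le_weightedMass hs u) fun h => ?_
  have hle : (fun t => ENNReal.ofReal
      (|u t| ^ (2 : ℝ) / boundaryDist (Ioo a b) t ^ (s * 2))) ≤ᵐ[volume.restrict (Ioo a b)]
      fun t => ENNReal.ofReal (|u t| ^ 2 * intervalWeight a b t ^ (2 * s)) := by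
    refine (ae_restrict_iff' measurableSet_Ioo).2 (Filter.Eventually.of_forall fun t ht => ?_)
    refine ENNReal.ofReal_le_ofReal ?_
    rw [hardyIntegrand_eq ht]
    exact mul_le_mul_of_nonneg_left (inv_boundaryDist_rpow_lt hs ht).le (by positivity)
  have hu' := hu.restrict (s := Ioo a b)
  have hae := ae_eq_of_ae_le_of_lintegral_le hle
    (by change hardyIntegral s 2 (Ioo a b) u ≠ ⊤; rw [h1]; exact ENNReal.one_ne_top)
    (by fun_prop) (by change weightedMass s a b u ≤ hardyIntegral s 2 (Ioo a b) u; rw [h1, h])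
  have h0 : hardyIntegral s 2 (Ioo a b) u = 0 := by
    refine (lintegral_congr_ae ?_).trans lintegral_zero
    rw [Filter.EventuallyEq, ae_restrict_iff' measurableSet_Ioo] at hae ⊢
    filter_upwards [hae] with t ht htm
    have h2 := ht htm
    have hd := boundaryDist_Ioo_pos htm
    have hw := intervalWeight_pos htm
    rw [ENNReal.ofReal_eq_ofReal_iff (by positivity) (by positivity),
      hardyIntegrand_eq htm] at h2
    have hlt := inv_boundaryDist_rpow_lt hs htm
    have : |u t| ^ 2 = 0 := by
      by_contra hne
      exact hlt.ne (mul_left_cancel₀ hne h2)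
    rw [hardyIntegrand_eq htm, this, zero_mul, ENNReal.ofReal_zero]
  rw [h0] at h1
  exact zero_ne_one h1

theorem not_hardyConstantAttained (hs0 : 0 < s) (hs1 : s < 1)
    (hle : hardyConstant s 2 (Ioo a b) ≤ sharpConstant s 2) :
    ¬ HardyConstantAttained s 2 (Ioo a b) := by
  rintro ⟨u, hu, h1, h2⟩
  have h3 := hu.hardy_inequality hs0 hs1
  rw [← ENNReal.rpow_two, h2] at h3
  have h4 := hardyIntegral_lt_weightedMass hs0 hu.1.1.1.aemeasurable h1
  have h5 := ENNReal.mul_lt_mul_right (sharpConstant_ne_zero hs0)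
    (sharpConstant_lt_top hs0 hs1).ne h4
  rw [mul_one] at h5
  exact absurd (h3.trans hle) (not_le.2 h5)

end Distance

/-! ### Energy in logarithmic coordinates. -/

section Logarithmic

variable {s a b : ℝ}

/-- The logarithmic coordinate on the interval. -/
noncomputable def logCoord (a b x : ℝ) : ℝ := Real.log ((x - a) / (b - x))

theorem measurable_logCoord (a b : ℝ) : Measurable (logCoord a b) := by
  unfold logCoord
  fun_prop

theorem hasDerivAt_logCoord {x : ℝ} (hx : x ∈ Ioo a b) :
    HasDerivAt (logCoord a b) (intervalWeight a b x) x := by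
  have hp : 0 < x - a := sub_pos.2 hx.1
  have hq : 0 < b - x := sub_pos.2 hx.2
  have d := (((hasDerivAt_id x).sub_const a).div ((hasDerivAt_id x).const_sub b) hq.ne').log
    (div_pos hp hq).ne'
  refine d.congr_deriv ?_
  simp only [id, Pi.div_apply]
  unfold intervalWeight
  field_simp
  ring

theorem logCoord_injOn : InjOn (logCoord a b) (Ioo a b) := by
  intro x hx y hy h
  have hp : 0 < x - a := sub_pos.2 hx.1
  have hq : 0 < b - x := sub_pos.2 hx.2
  have hp' : 0 < y - a := sub_pos.2 hy.1
  have hq' : 0 < b - y := sub_pos.2 hy.2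
  have h1 := Real.log_injOn_pos (div_pos hp hq) (div_pos hp' hq') h
  rw [div_eq_div_iff hq.ne' hq'.ne'] at h1
  have h2 : (b - a) * (x - y) = 0 := by linarith
  have h3 : b - a ≠ 0 := by linarith
  have h4 := (mul_eq_zero.1 h2).resolve_left h3
  linarith

theorem exists_logCoord_eq (hab : a < b) (r : ℝ) : ∃ x ∈ Ioo a b, logCoord a b x = r := by
  have he := Real.exp_pos r
  have hl : 0 < b - a := sub_pos.2 hab
  have e1 : (a + Real.exp r * b) / (1 + Real.exp r) - a =
      Real.exp r * (b - a) / (1 + Real.exp r) := by field_simp; ring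
  have e2 : b - (a + Real.exp r * b) / (1 + Real.exp r) = (b - a) / (1 + Real.exp r) := by
    field_simp; ring
  have p1 : 0 < Real.exp r * (b - a) / (1 + Real.exp r) := by positivity
  have p2 : 0 < (b - a) / (1 + Real.exp r) := by positivity
  refine ⟨(a + Real.exp r * b) / (1 + Real.exp r), ⟨by linarith, by linarith⟩, ?_⟩
  unfold logCoord
  rw [e1, e2]
  have : Real.exp r * (b - a) / (1 + Real.exp r) / ((b - a) / (1 + Real.exp r)) = Real.exp r := by
    field_simp
  rw [this, Real.log_exp]

/-- The weight is the derivative of the logarithmic coordinate, so it pulls back Lebesgue measure on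
the line. -/
theorem lintegral_intervalWeight (hab : a < b) {α β : ℝ} :
    ∫⁻ x in Ioo a b ∩ logCoord a b ⁻¹' Ioo α β, ENNReal.ofReal (intervalWeight a b x) =
      ENNReal.ofReal (β - α) := by
  have hm : MeasurableSet (Ioo a b ∩ logCoord a b ⁻¹' Ioo α β) :=
    measurableSet_Ioo.inter (measurable_logCoord a b measurableSet_Ioo)
  have himg : logCoord a b '' (Ioo a b ∩ logCoord a b ⁻¹' Ioo α β) = Ioo α β := by
    ext r
    constructor
    · rintro ⟨x, hx, rfl⟩
      exact hx.2
    · intro hr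
      obtain ⟨x, hx, rfl⟩ := exists_logCoord_eq hab r
      exact ⟨x, ⟨hx, hr⟩, rfl⟩
  have h := lintegral_image_eq_lintegral_abs_deriv_mul hm
    (fun x hx => (hasDerivAt_logCoord hx.1).hasDerivWithinAt)
    (logCoord_injOn.mono inter_subset_left) 1
  rw [himg] at h
  simp only [Pi.one_apply, mul_one, lintegral_const, Measure.restrict_apply_univ,
    Real.volume_Ioo, one_mul] at h
  rw [h]
  exact setLIntegral_congr_fun hm fun x hx => by
    rw [abs_of_pos (intervalWeight_pos hx.1)]

/-- Hence the weighted mass of w h is a constant times the plain squared L^2 norm of h in the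
logarithmic coordinate. -/
theorem groundState_sq_mul_weight {x : ℝ} (hx : x ∈ Ioo a b) :
    groundState s a b x ^ 2 * intervalWeight a b x ^ (2 * s) =
      (b - a) ^ (2 * s - 1) * intervalWeight a b x := by
  have hp : 0 < x - a := sub_pos.2 hx.1
  have hq : 0 < b - x := sub_pos.2 hx.2
  have hl : 0 < b - a := by linarith
  have hpq : 0 < (x - a) * (b - x) := mul_pos hp hq
  rw [groundState_of_mem hx, intervalWeight_eq hx, Real.div_rpow hl.le hpq.le,
    Real.rpow_sub_one hl.ne']
  generalize (x - a) * (b - x) = P at *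
  have : P ^ (2 * s) = (P ^ (s - 1 / 2)) ^ 2 * P := by
    rw [← Real.rpow_natCast, ← Real.rpow_mul hpq.le, ← Real.rpow_add_one hpq.ne']
    congr 1; push_cast; ring
  have h0 : P ^ (s - 1 / 2) ≠ 0 := (Real.rpow_pos_of_pos hpq _).ne'
  rw [this]
  field_simp

theorem log_crossRatio {x y : ℝ} (hx : x ∈ Ioo a b) (hy : y ∈ Ioo a b) :
    Real.log (crossRatio a b x y) = logCoord a b y - logCoord a b x := by
  have hp : 0 < x - a := sub_pos.2 hx.1
  have hq : 0 < b - x := sub_pos.2 hx.2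
  have hp' : 0 < y - a := sub_pos.2 hy.1
  have hq' : 0 < b - y := sub_pos.2 hy.2
  unfold logCoord crossRatio
  rw [← Real.log_div (by positivity) (by positivity)]
  congr 1
  field_simp

theorem lintegral_groundState_log (hs : 0 < s) {x : ℝ} (hx : x ∈ Ioo a b) :
    ∫⁻ y, ENNReal.ofReal (groundState s a b y * gagliardoKernel s x y) *
        ENNReal.ofReal ((logCoord a b x - logCoord a b y) ^ 2) =
      ENNReal.ofReal (groundState s a b x * intervalWeight a b x ^ (2 * s)) *
        (2 * ∫⁻ t in Ioo (0 : ℝ) 1, ENNReal.ofReal (radialKernel s t) *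
          ENNReal.ofReal (Real.log t ^ 2)) := by
  refine lintegral_groundState hs hx (F := fun t => ENNReal.ofReal (Real.log t ^ 2))
    (fun y hy => ?_) (fun y hy => ?_)
  · rw [log_crossRatio hx ⟨hy.1, hy.2.trans hx.2⟩, ← neg_sq, neg_sub]
  · rw [log_crossRatio ⟨hx.1.trans hy.1, hy.2⟩ hx]

/-- Energy bound for functions that are Lipschitz in the logarithmic coordinate. -/
theorem groundEnergy_le (hs : 0 < s) (hab : a < b) {h : ℝ → ℝ} {c α β : ℝ}
    (hlip : ∀ x ∈ Ioo a b, ∀ y ∈ Ioo a b,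
      (h x - h y) ^ 2 ≤ c ^ 2 * (logCoord a b x - logCoord a b y) ^ 2)
    (hsupp : ∀ x ∈ Ioo a b, logCoord a b x ∉ Ioo α β → h x = 0) :
    groundEnergy s a b univ h ≤
      4 * (∫⁻ t in Ioo (0 : ℝ) 1, ENNReal.ofReal (radialKernel s t) *
        ENNReal.ofReal (Real.log t ^ 2)) * ENNReal.ofReal (c ^ 2) *
        (ENNReal.ofReal ((b - a) ^ (2 * s - 1)) * ENNReal.ofReal (β - α)) := by
  set S : Set ℝ := Ioo a b ∩ logCoord a b ⁻¹' Ioo α β with hS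
  set I : ℝ≥0∞ := ∫⁻ t in Ioo (0 : ℝ) 1, ENNReal.ofReal (radialKernel s t) *
        ENNReal.ofReal (Real.log t ^ 2)
  have hm : MeasurableSet S :=
    measurableSet_Ioo.inter (measurable_logCoord a b measurableSet_Ioo)
  have mw := measurable_groundState s a b
  have mk := measurable_gagliardoKernel s
  have ml := measurable_logCoord a b
  set w := groundState s a b with hw
  have w0 : ∀ x, 0 ≤ w x := groundState_nonneg s a b
  have k0 : ∀ x y, 0 ≤ gagliardoKernel s x y := gagliardoKernel_nonneg s
  -- A pair contributes only if one of its points lies in S. The function g charges pairs with first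
  -- point in S; adding its swap covers the rest and doubles the constant.
  set g : ℝ × ℝ → ℝ≥0∞ := fun z => S.indicator 1 z.1 * ENNReal.ofReal (w z.1 * c ^ 2 *
    (w z.2 * gagliardoKernel s z.1 z.2 * (logCoord a b z.1 - logCoord a b z.2) ^ 2)) with hg
  have mg : Measurable g := by
    have : Measurable (S.indicator (1 : ℝ → ℝ≥0∞)) := measurable_one.indicator hm
    fun_prop
  have hpt : ∀ z : ℝ × ℝ, ENNReal.ofReal (w z.1 * w z.2 * (h z.1 - h z.2) ^ 2 *
      gagliardoKernel s z.1 z.2) ≤ g z + g z.swap := by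
    rintro ⟨x, y⟩
    simp only [hg, Prod.swap_prod_mk]
    by_cases hx : x ∈ Ioo a b
    swap
    · simp [hw, groundState_of_notMem hx]
    by_cases hy : y ∈ Ioo a b
    swap
    · simp [hw, groundState_of_notMem hy]
    have key : w x * w y * (h x - h y) ^ 2 * gagliardoKernel s x y ≤ w x * c ^ 2 *
        (w y * gagliardoKernel s x y * (logCoord a b x - logCoord a b y) ^ 2) := by
      have := mul_le_mul_of_nonneg_left (hlip x hx y hy)
        (mul_nonneg (mul_nonneg (w0 x) (w0 y)) (k0 x y))
      linarith
    by_cases hxS : x ∈ S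
    · rw [indicator_of_mem hxS, Pi.one_apply, one_mul]
      exact le_add_right (ENNReal.ofReal_le_ofReal key)
    by_cases hyS : y ∈ S
    · rw [indicator_of_mem hyS, Pi.one_apply, one_mul]
      refine le_add_left (ENNReal.ofReal_le_ofReal (key.trans_eq ?_))
      rw [gagliardoKernel_comm s x y]
      ring
    · rw [hsupp x hx fun h' => hxS ⟨hx, h'⟩, hsupp y hy fun h' => hyS ⟨hy, h'⟩]
      simp
  have hint : ∫⁻ z, g z = ENNReal.ofReal (c ^ 2) * (2 * I) *
      (ENNReal.ofReal ((b - a) ^ (2 * s - 1)) * ENNReal.ofReal (β - α)) := by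
    rw [Measure.volume_eq_prod, lintegral_prod _ mg.aemeasurable,
      ← lintegral_intervalWeight hab, ← hS, ← lintegral_const_mul' _ _ ENNReal.ofReal_ne_top,
      ← lintegral_const_mul _ (by have := measurable_intervalWeight a b; fun_prop),
      ← lintegral_indicator hm]
    refine lintegral_congr fun x => ?_
    by_cases hx : x ∈ S
    · have hi := lintegral_groundState_log hs hx.1
      simp only [hg, indicator_of_mem hx, Pi.one_apply, one_mul]
      have e : ∀ y, ENNReal.ofReal (w x * c ^ 2 *
          (w y * gagliardoKernel s x y * (logCoord a b x - logCoord a b y) ^ 2)) =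
          ENNReal.ofReal (w x * c ^ 2) * (ENNReal.ofReal (w y * gagliardoKernel s x y) *
          ENNReal.ofReal ((logCoord a b x - logCoord a b y) ^ 2)) := by
        intro y
        rw [ENNReal.ofReal_mul (mul_nonneg (w0 x) (sq_nonneg c)),
          ENNReal.ofReal_mul (mul_nonneg (w0 y) (k0 x y))]
      have hb : 0 ≤ (b - a) ^ (2 * s - 1) := Real.rpow_nonneg (sub_pos.2 hab).le _
      simp only [e]
      rw [lintegral_const_mul' _ _ ENNReal.ofReal_ne_top, hi, ← ENNReal.ofReal_mul hb,
        ← groundState_sq_mul_weight hx.1, ← mul_assoc,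
        ← ENNReal.ofReal_mul (mul_nonneg (w0 x) (sq_nonneg c)), mul_right_comm (ENNReal.ofReal (c ^ 2)),
        ← ENNReal.ofReal_mul (sq_nonneg c)]
      congr 2
      ring
    · simp only [hg, indicator_of_notMem hx, zero_mul, lintegral_zero]
  have hsw : ∫⁻ z : ℝ × ℝ, g z.swap = ∫⁻ z, g z := by
    rw [Measure.volume_eq_prod]
    exact lintegral_prod_swap g
  unfold groundEnergy
  rw [Measure.restrict_univ]
  refine (lintegral_mono hpt).trans ?_
  rw [lintegral_add_left mg, hsw, hint]
  apply le_of_eq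
  ring

end Logarithmic

/-! ### Normalization of the Hardy quotient. -/

section Scaling

variable {s : ℝ} {Ω : Set ℝ} {u : ℝ → ℝ}

theorem IsTestFunction.const_mul (hu : IsTestFunction Ω u) (c : ℝ) :
    IsTestFunction Ω (fun x => c * u x) := by
  have hsub : tsupport (fun x => c * u x) ⊆ tsupport u :=
    closure_mono fun x hx h => hx (by simp [h])
  exact ⟨contDiff_const.mul hu.1, hu.2.1.mul_left, hsub.trans hu.2.2⟩

theorem hardyIntegral_const_mul (c : ℝ) :
    hardyIntegral s 2 Ω (fun x => c * u x) = ENNReal.ofReal (c ^ 2) * hardyIntegral s 2 Ω u := by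
  unfold hardyIntegral
  rw [← lintegral_const_mul' _ _ ENNReal.ofReal_ne_top]
  refine lintegral_congr fun x => ?_
  rw [← ENNReal.ofReal_mul (sq_nonneg c), abs_mul, Real.mul_rpow (abs_nonneg _) (abs_nonneg _),
    Real.rpow_two, sq_abs, mul_div_assoc]

theorem gagliardoEnergy_const_mul (c : ℝ) (R : Set (ℝ × ℝ)) :
    gagliardoEnergy s R (fun x => c * u x) = ENNReal.ofReal (c ^ 2) * gagliardoEnergy s R u := by
  unfold gagliardoEnergy
  rw [← lintegral_const_mul' _ _ ENNReal.ofReal_ne_top]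
  refine lintegral_congr fun x => ?_
  rw [← ENNReal.ofReal_mul (sq_nonneg c)]
  congr 1
  ring

theorem hardyConstant_mul_le (hu : IsTestFunction Ω u) (h0 : hardyIntegral s 2 Ω u ≠ 0)
    (ht : hardyIntegral s 2 Ω u ≠ ⊤) :
    hardyConstant s 2 Ω * hardyIntegral s 2 Ω u ≤ gagliardoEnergy s univ u := by
  set N := hardyIntegral s 2 Ω u with hN
  have hNr : 0 < N.toReal := ENNReal.toReal_pos h0 ht
  set c : ℝ := (Real.sqrt N.toReal)⁻¹
  have hc : ENNReal.ofReal (c ^ 2) = N⁻¹ := by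
    rw [inv_pow, Real.sq_sqrt hNr.le, ENNReal.ofReal_inv_of_pos hNr, ENNReal.ofReal_toReal ht]
  have h1 : hardyIntegral s 2 Ω (fun x => c * u x) = 1 := by
    rw [hardyIntegral_const_mul, hc, ← hN, ENNReal.inv_mul_cancel h0 ht]
  have h2 : hardyConstant s 2 Ω ≤ gagliardoSeminorm s 2 (fun x => c * u x) ^ (2 : ℝ) :=
    iInf_le_of_le _ (iInf_le_of_le (hu.const_mul c) (iInf_le_of_le h1 le_rfl))
  rw [ENNReal.rpow_two, gagliardoSeminorm_sq, gagliardoEnergy_const_mul, hc, mul_comm,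
    ← div_eq_mul_inv] at h2
  exact (ENNReal.le_div_iff_mul_le (Or.inl h0) (Or.inl ht)).1 h2

end Scaling

/-! ### Optimality through stretched bumps near a. -/

section Optimality

variable {s a b : ℝ}

/-- A bump function, placed in logarithmic coordinates. -/
noncomputable def logBump : ContDiffBump (-2 : ℝ) := ⟨1 / 2, 1, by norm_num, by norm_num⟩

/-- The bump, stretched by the factor `T` and pulled back to the interval. -/
noncomputable def stretchedBump (a b T x : ℝ) : ℝ := logBump (logCoord a b x / T)

theorem measurable_stretchedBump (a b T : ℝ) : Measurable (stretchedBump a b T) :=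
  logBump.continuous.measurable.comp ((measurable_logCoord a b).div_const T)

theorem stretchedBump_eq_zero {T x : ℝ} (hT : 0 < T)
    (hx : logCoord a b x ∉ Ioo (-(3 * T)) (-T)) : stretchedBump a b T x = 0 := by
  refine logBump.zero_of_le_dist ?_
  change 1 ≤ _
  by_contra h
  rw [not_le, Real.dist_eq, abs_lt] at h
  apply hx
  have h1 := h.1
  have h2 := h.2
  rw [lt_sub_iff_add_lt, lt_div_iff₀ hT] at h1
  rw [sub_lt_iff_lt_add, div_lt_iff₀ hT] at h2
  constructor <;> linarith

theorem stretchedBump_eq_one {T x : ℝ} (hT : 0 < T)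
    (hx : logCoord a b x ∈ Ioo (-(5 / 2 * T)) (-(3 / 2 * T))) : stretchedBump a b T x = 1 := by
  refine logBump.one_of_mem_closedBall ?_
  change _ ∈ Metric.closedBall _ (1 / 2)
  rw [Metric.mem_closedBall, Real.dist_eq, abs_le, le_sub_iff_add_le, le_div_iff₀ hT,
    sub_le_iff_le_add, div_le_iff₀ hT]
  have h1 := hx.1
  have h2 := hx.2
  constructor <;> linarith

theorem exists_lipschitz_stretchedBump :
    ∃ L : ℝ, ∀ a b T x y : ℝ, 0 < T → (stretchedBump a b T x - stretchedBump a b T y) ^ 2 ≤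
      (L / T) ^ 2 * (logCoord a b x - logCoord a b y) ^ 2 := by
  obtain ⟨C, hC⟩ := ContDiff.lipschitzWith_of_hasCompactSupport (𝕂 := ℝ) (n := 1)
    logBump.hasCompactSupport logBump.contDiff (by norm_num)
  refine ⟨C, fun a b T x y hT => ?_⟩
  have h := hC.dist_le_mul (logCoord a b x / T) (logCoord a b y / T)
  rw [Real.dist_eq, Real.dist_eq] at h
  have h2 := pow_le_pow_left₀ (abs_nonneg _) h 2
  rw [mul_pow, sq_abs, sq_abs, ← sub_div] at h2
  unfold stretchedBump
  refine h2.trans_eq ?_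
  field_simp

theorem isTestFunction_groundState_mul_stretchedBump (hab : a < b) {T : ℝ} (hT : 0 < T) :
    IsTestFunction (Ioo a b) (fun x => groundState s a b x * stretchedBump a b T x) := by
  set r := Real.exp (-(3 * T)) with hr
  have hr0 : 0 < r := Real.exp_pos _
  -- The endpoints of K have logarithmic coordinates -3T and 0, so K contains the support and stays
  -- inside the interval.
  set K : Set ℝ := Icc ((a + r * b) / (1 + r)) ((a + b) / 2) with hK
  have hKsub : K ⊆ Ioo a b := by
    intro x hx
    refine ⟨lt_of_lt_of_le ?_ hx.1, lt_of_le_of_lt hx.2 (by linarith)⟩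
    rw [lt_div_iff₀ (by positivity)]
    nlinarith
  have hsupp : Function.support (fun x => groundState s a b x * stretchedBump a b T x) ⊆ K := by
    intro x hx
    have h1 : x ∈ Ioo a b := by
      by_contra h
      exact hx (by simp [groundState_of_notMem h])
    have h2 : logCoord a b x ∈ Ioo (-(3 * T)) (-T) := by
      by_contra h
      exact hx (by simp [stretchedBump_eq_zero hT h])
    have hp : 0 < x - a := sub_pos.2 h1.1
    have hq : 0 < b - x := sub_pos.2 h1.2
    have h3 := h2.1
    have h4 : logCoord a b x < 0 := h2.2.trans (by linarith)
    unfold logCoord at h3 h4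
    rw [Real.lt_log_iff_exp_lt (div_pos hp hq), ← hr, lt_div_iff₀ hq] at h3
    rw [Real.log_neg_iff (div_pos hp hq), div_lt_one hq] at h4
    refine ⟨?_, by linarith⟩
    rw [div_le_iff₀ (by positivity)]
    linarith
  have hts : tsupport (fun x => groundState s a b x * stretchedBump a b T x) ⊆ K :=
    closure_minimal hsupp isClosed_Icc
  refine ⟨contDiff_iff_contDiffAt.2 fun x => ?_,
    HasCompactSupport.of_support_subset_isCompact isCompact_Icc hsupp, hts.trans hKsub⟩
  by_cases hx : x ∈ Ioo a b
  · have hp : 0 < x - a := sub_pos.2 hx.1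
    have hq : 0 < b - x := sub_pos.2 hx.2
    have h1 : ContDiffAt ℝ ∞ (fun x => ((x - a) * (b - x)) ^ (s - 1 / 2) *
        logBump (Real.log ((x - a) / (b - x)) / T)) x := by
      refine ContDiffAt.mul ?_ ?_
      · exact ContDiffAt.rpow_const_of_ne (by fun_prop) (mul_pos hp hq).ne'
      · refine logBump.contDiffAt.comp x (ContDiffAt.div_const ?_ T)
        exact ContDiffAt.log (ContDiffAt.div (by fun_prop) (by fun_prop) hq.ne') (div_pos hp hq).ne'
    refine h1.congr_of_eventuallyEq ?_
    filter_upwards [isOpen_Ioo.mem_nhds hx] with y hy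
    rw [groundState_of_mem hy]
    rfl
  · have h2 : x ∉ tsupport (fun x => groundState s a b x * stretchedBump a b T x) :=
      fun h => hx (hKsub (hts h))
    exact (contDiffAt_const (c := (0 : ℝ))).congr_of_eventuallyEq
      (notMem_tsupport_iff_eventuallyEq.1 h2)

theorem le_weightedMass_stretchedBump (hab : a < b) {T : ℝ} (hT : 0 < T) :
    ENNReal.ofReal ((b - a) ^ (2 * s - 1)) * ENNReal.ofReal T ≤
      weightedMass s a b (fun x => groundState s a b x * stretchedBump a b T x) := by
  have hm : MeasurableSet (Ioo a b ∩ logCoord a b ⁻¹' Ioo (-(5 / 2 * T)) (-(3 / 2 * T))) :=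
    measurableSet_Ioo.inter (measurable_logCoord a b measurableSet_Ioo)
  have e : T = -(3 / 2 * T) - -(5 / 2 * T) := by ring
  conv_lhs => rw [e]
  rw [← lintegral_intervalWeight hab, ← lintegral_const_mul' _ _ ENNReal.ofReal_ne_top]
  refine le_trans (le_of_eq (setLIntegral_congr_fun hm fun x hx => ?_))
    (lintegral_mono_set (inter_subset_left
      (t := logCoord a b ⁻¹' Ioo (-(5 / 2 * T)) (-(3 / 2 * T)))))
  simp only
  rw [stretchedBump_eq_one hT hx.2, mul_one, sq_abs, groundState_sq_mul_weight hx.1,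
    ENNReal.ofReal_mul (Real.rpow_nonneg (sub_pos.2 hab).le _)]

/-- On the support x - a < e^(-T)(b-x), so d = x - a and dW = 1 + (x-a)/(b-x) < 1 + e^(-T), while (1
- e^(-T))(1 + e^(-T)) < 1. -/
theorem le_hardyIntegral_stretchedBump (hs : 0 < s) {T : ℝ} (hT : 0 < T) :
    ENNReal.ofReal ((1 - Real.exp (-T)) ^ (2 * s)) *
        weightedMass s a b (fun x => groundState s a b x * stretchedBump a b T x) ≤
      hardyIntegral s 2 (Ioo a b) (fun x => groundState s a b x * stretchedBump a b T x) := by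
  have hE : Real.exp (-T) < 1 := Real.exp_lt_one_iff.2 (by linarith)
  have hE0 := Real.exp_pos (-T)
  unfold weightedMass
  rw [← lintegral_const_mul' _ _ ENNReal.ofReal_ne_top]
  refine setLIntegral_mono' measurableSet_Ioo fun x hx => ?_
  rw [hardyIntegrand_eq hx fun x => groundState s a b x * stretchedBump a b T x,
    ← ENNReal.ofReal_mul (Real.rpow_nonneg (by linarith) _)]
  refine ENNReal.ofReal_le_ofReal ?_
  by_cases h : logCoord a b x ∈ Ioo (-(3 * T)) (-T)
  swap
  · simp [stretchedBump_eq_zero hT h]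
  have hw := intervalWeight_pos hx
  rw [mul_left_comm, ← Real.mul_rpow (by linarith) hw.le]
  have hp : 0 < x - a := sub_pos.2 hx.1
  have hq : 0 < b - x := sub_pos.2 hx.2
  have h2 := h.2
  unfold logCoord at h2
  rw [Real.log_lt_iff_lt_exp (div_pos hp hq), div_lt_iff₀ hq] at h2
  have hxa : x - a ≤ b - x := by nlinarith
  refine mul_le_mul_of_nonneg_left (Real.rpow_le_rpow (mul_nonneg (by linarith) hw.le) ?_
    (by linarith)) (by positivity)
  rw [boundaryDist_Ioo hx, min_eq_left hxa, intervalWeight_eq hx, ← one_div, ← mul_div_assoc,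
    div_le_div_iff₀ (by positivity) (by positivity)]
  nlinarith [mul_nonneg hp.le (mul_nonneg hE0.le hp.le),
    mul_le_mul_of_nonneg_left (show (1 - Real.exp (-T)) * (b - a) ≤ b - x by nlinarith) hp.le]

theorem exists_hardyConstant_mul_le (hs0 : 0 < s) (hs1 : s < 1) (hab : a < b) :
    ∃ C : ℝ≥0∞, C ≠ ⊤ ∧ ∀ T : ℝ, 0 < T →
      hardyConstant s 2 (Ioo a b) * ENNReal.ofReal ((1 - Real.exp (-T)) ^ (2 * s)) ≤
        C * ENNReal.ofReal ((1 / T) ^ 2) + sharpConstant s 2 := by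
  obtain ⟨L, hL⟩ := exists_lipschitz_stretchedBump
  -- The 8 is the 4 of the energy bound times 2, the ratio of the support length 2T to the length T
  -- of the plateau that bounds the mass from below.
  refine ⟨8 * (∫⁻ t in Ioo (0 : ℝ) 1, ENNReal.ofReal (radialKernel s t) *
        ENNReal.ofReal (Real.log t ^ 2)) * ENNReal.ofReal (L ^ 2),
    ENNReal.mul_ne_top (ENNReal.mul_ne_top (by simp)
      (lintegral_radialKernel_mul_log_sq_lt_top hs0 hs1).ne) ENNReal.ofReal_ne_top,
    fun T hT => ?_⟩
  set I : ℝ≥0∞ := ∫⁻ t in Ioo (0 : ℝ) 1, ENNReal.ofReal (radialKernel s t) *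
        ENNReal.ofReal (Real.log t ^ 2)
  set u : ℝ → ℝ := fun x => groundState s a b x * stretchedBump a b T x with hu
  have htest : IsTestFunction (Ioo a b) u := isTestFunction_groundState_mul_stretchedBump hab hT
  have hfin : weightedMass s a b u < ⊤ := htest.weightedMass_lt_top
  have hE : Real.exp (-T) < 1 := Real.exp_lt_one_iff.2 (by linarith)
  have hmass := le_weightedMass_stretchedBump (s := s) hab hT
  have hhardy := le_hardyIntegral_stretchedBump (a := a) (b := b) hs0 hT
  rw [← hu] at hmass hhardy
  have hmass0 : weightedMass s a b u ≠ 0 := by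
    refine (lt_of_lt_of_le ?_ hmass).ne'
    rw [← ENNReal.ofReal_mul (Real.rpow_nonneg (sub_pos.2 hab).le _)]
    exact ENNReal.ofReal_pos.2 (mul_pos (Real.rpow_pos_of_pos (sub_pos.2 hab) _) hT)
  have hhardy0 : hardyIntegral s 2 (Ioo a b) u ≠ 0 := by
    refine (lt_of_lt_of_le ?_ hhardy).ne'
    exact ENNReal.mul_pos (ENNReal.ofReal_pos.2 (Real.rpow_pos_of_pos (by linarith) _)).ne' hmass0
  have hhardyt : hardyIntegral s 2 (Ioo a b) u ≠ ⊤ :=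
    ne_top_of_le_ne_top hfin.ne (hardyIntegral_le_weightedMass hs0 u)
  have h1 := hardyConstant_mul_le htest hhardy0 hhardyt
  have h2 := gagliardoEnergy_le hs0 hs1 hab (measurable_stretchedBump a b T) hfin
  have h3 := groundEnergy_le (s := s) hs0 hab
    (fun x _ y _ => hL a b T x y hT) (fun x _ hx => stretchedBump_eq_zero hT hx)
  have h4 : groundEnergy s a b univ (stretchedBump a b T) ≤
      8 * I * ENNReal.ofReal (L ^ 2) * ENNReal.ofReal ((1 / T) ^ 2) * weightedMass s a b u := by
    refine h3.trans ?_
    have e1 : -T - -(3 * T) = 2 * T := by ring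
    have e2 : (L / T) ^ 2 = L ^ 2 * (1 / T) ^ 2 := by ring
    rw [e1, e2, ENNReal.ofReal_mul (p := 2) (by norm_num), ENNReal.ofReal_mul (sq_nonneg L),
      ENNReal.ofReal_ofNat]
    calc _ = 8 * I * ENNReal.ofReal (L ^ 2) * ENNReal.ofReal ((1 / T) ^ 2) *
          (ENNReal.ofReal ((b - a) ^ (2 * s - 1)) * ENNReal.ofReal T) := by ring
      _ ≤ _ := by gcongr
  -- Multiplying by the mass, which is finite and nonzero, puts the claim in the form of the energy
  -- bounds and makes C independent of T.
  refine (ENNReal.mul_le_mul_iff_left hmass0 hfin.ne).1 ?_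
  calc _ = hardyConstant s 2 (Ioo a b) * (ENNReal.ofReal ((1 - Real.exp (-T)) ^ (2 * s)) *
        weightedMass s a b u) := by ring
    _ ≤ hardyConstant s 2 (Ioo a b) * hardyIntegral s 2 (Ioo a b) u := by gcongr
    _ ≤ gagliardoEnergy s univ u := h1
    _ ≤ _ := h2
    _ ≤ _ := add_le_add_left h4 _
    _ = _ := by rw [← add_mul]

theorem hardyConstant_le_sharpConstant (hs0 : 0 < s) (hs1 : s < 1) (hab : a < b) :
    hardyConstant s 2 (Ioo a b) ≤ sharpConstant s 2 := by
  obtain ⟨C, hC, h⟩ := exists_hardyConstant_mul_le hs0 hs1 hab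
  have hE : Filter.Tendsto (fun T : ℝ => Real.exp (-T)) Filter.atTop (nhds 0) :=
    Real.tendsto_exp_neg_atTop_nhds_zero
  have t1 : Filter.Tendsto (fun T : ℝ => ENNReal.ofReal ((1 - Real.exp (-T)) ^ (2 * s)))
      Filter.atTop (nhds 1) := by
    have := ((tendsto_const_nhds (x := (1 : ℝ))).sub hE).rpow_const (p := 2 * s)
      (Or.inl (by norm_num))
    simpa using ENNReal.tendsto_ofReal this
  have t2 : Filter.Tendsto (fun T : ℝ => ENNReal.ofReal ((1 / T) ^ 2))
      Filter.atTop (nhds 0) := by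
    have := ((tendsto_const_nhds (x := (1 : ℝ))).div_atTop Filter.tendsto_id).pow 2
    simpa using ENNReal.tendsto_ofReal this
  have t3 := ENNReal.Tendsto.const_mul (a := hardyConstant s 2 (Ioo a b)) t1
    (Or.inl one_ne_zero)
  have t4 := (ENNReal.Tendsto.const_mul (a := C) t2 (Or.inr hC)).add_const (sharpConstant s 2)
  rw [mul_one] at t3
  rw [mul_zero, zero_add] at t4
  refine le_of_tendsto_of_tendsto t3 t4 ?_
  filter_upwards [Filter.eventually_gt_atTop 0] with T hT using h T hT

end Optimality

end FractionalHardy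

theorem mainTheorem6 (s : ℝ) (hs0 : 0 < s) (hs1 : s < 1) (a b : ℝ) (hab : a < b) :
    FractionalHardy.sharpConstant s 2 < ⊤ ∧
    (∀ u : ℝ → ℝ, FractionalHardy.MemSobolevTildeZero s 2 (Ioo a b) u →
      FractionalHardy.sharpConstant s 2 *
          (∫⁻ t in Ioo a b,
            ENNReal.ofReal (|u t| ^ 2 * (1 / (t - a) + 1 / (b - t)) ^ (2 * s)))
        ≤ FractionalHardy.gagliardoSeminorm s 2 u ^ 2) ∧
    FractionalHardy.hardyConstant s 2 (Ioo a b) = FractionalHardy.sharpConstant s 2 ∧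
    ¬ FractionalHardy.HardyConstantAttained s 2 (Ioo a b) := by
  have hle := FractionalHardy.hardyConstant_le_sharpConstant hs0 hs1 hab
  exact ⟨FractionalHardy.sharpConstant_lt_top hs0 hs1,
    fun u hu => hu.hardy_inequality hs0 hs1,
    le_antisymm hle (FractionalHardy.sharpConstant_le_hardyConstant hs0 hs1),
    FractionalHardy.not_hardyConstantAttained hs0 hs1 hle⟩
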